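/- **Proposition 5.1.** Let $k\ge 2$ and let $P\subset\mathbb R^3$ be a bounded polyhedron with planar faces $f$, straight edges $e$ and diameter $h_P$. Assume that, for some $\rho>0$, $P$ is star-shaped with respect to a ball of radius $\ge\rho h_P$, every face is star-shaped with respect to a disk of radius $\ge\rho h_P$, and every edge has length $\ge\rho h_P$. On each face $f$ fix Cartesian coordinates along orthonormal vectors $\tau_1^f,\tau_2^f$ such that $\tau_1^f\wedge\tau_2^f=n_P^f$ is the outward unit normal. *Polynomials and projections.* $\mathbb P_n(\mathcal O)$ is the space of polynomials of degree $\le n$ on $\mathcal O$ (with $\mathbb P_n=\{0\}$ for $n<0$), and $\widehat{\mathbb P}_{n\setminus m}(\mathcal O)$ is the space of those having only monomials of degree $>m$. For $\mathcal O=f$ or $\mathcal O=P$, the $L^2$-projection $\Pi_n^{0,\mathcal O}v\in\mathbb P_n(\mathcal O)$ is defined by $\int_{\mathcal O}q\,(v-\Pi_n^{0,\mathcal O}v)=0$ for all $q\in\mathbb P_n(\mathcal O)$. The $H^1$-seminorm projection $\Pi_n^{\nabla,\mathcal O}v\in\mathbb P_n(\mathcal O)$ is defined by $\int_{\mathcal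 O}\nabla q\cdot\nabla(v-\Pi_n^{\nabla,\mathcal O}v)=0$ for all $q\in\mathbb P_n(\mathcal O)$ and $\int_{\partial\mathcal O}(v-\Pi_n^{\nabla,\mathcal O}v)=0$. On vector and tensor fields both act componentwise. *Spaces.* $\widehat{\mathbb B}_k(f)$ is the set of $v\in H^1(f)$ such that $v|_{\partial f}\in C^0(\partial f)$, $v|_e\in\mathbb P_k(e)$ for every edge $e$ of $f$, $\Delta_f v\in\mathbb P_{k+1}(f)$, and $\int_f(v-\Pi_k^{\nabla,f}v)\,\widehat p=0$ for all $\widehat p\in\widehat{\mathbb P}_{k+1\setminus k-2}(f)$. The space $V_h(P)$ is the set of $v\in[H^1(P)]^3$ such that - $v|_{\partial P}\in[C^0(\partial P)]^3$ and $v|_f\in[\widehat{\mathbb B}_k(f)]^3$ for every face $f$; - $\Delta v+\nabla s\in x\wedge[\mathbb P_{k-1}(P)]^3$ for some $s\in L^2(P)$ with $\int_P s=0$; - $\operatorname{div}v\in\mathbb P_{k-1}(P)$; - $\int_P(v-\Pi_k^{\nabla,P}v)\cdot(x\wedge\widehat p)=0$ for all $\widehat p\in[\widehat{\mathbb P}_{k-1\setminus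 k-3}(P)]^3$. Boundary values are meant in the sense of traces, and differential operators in the sense of distributions. *Degrees of freedom $D_V$.* They are (1) the values of $v$ at the vertices of $P$; (2) the values of $v$ at $k-1$ fixed distinct interior points of every edge; (3) the moments $\int_f(v\cdot n_P^f)\,p$, $\int_f(v\cdot\tau_1^f)\,p$, $\int_f(v\cdot\tau_2^f)\,p$ for all faces $f$ and all $p\in\mathbb P_{k-2}(f)$; (4) the moments $\int_P v\cdot(x\wedge p)$ for all $p\in[\mathbb P_{k-3}(P)]^3$; (5) the moments $\int_P(\operatorname{div}v)\,\widehat p$ for all $\widehat p\in\widehat{\mathbb P}_{k-1\setminus 0}(P)$. *Claim.* For $v_h\in V_h(P)$, each of the polynomials $$\Pi_k^{\nabla,f}v_h,\qquad \Pi_{k+1}^{0,f}v_h\quad(\text{for every face } f\text{ of }P),$$ $$\Pi_k^{\nabla,P}v_h,\qquad \Pi_{k-1}^{0,P}(\nabla v_h),\qquad \Pi_k^{0,P}(\nabla v_h),\qquad \Pi_k^{0,P}v_h$$ exists, is unique, and is computed exactly from the degrees of freedom of $v_h$ alone: it is a linear combination of the values at $v_h$ of finitely many degrees of freedom in $D_V$.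 The choice of these degrees of freedom and the (polynomial) coefficients of the combination do not depend on $v_h$. -/

import Mathlib

open MeasureTheory Filter Topology Set
open scoped ContDiff ENNReal

noncomputable section

namespace VEM

/-- Euclidean space of dimension `d`. -/
abbrev E (d : ℕ) := EuclideanSpace ℝ (Fin d)

/-! ### Sobolev functions on an open set -/

/-- The `i`-th partial derivative of a smooth function. -/
def partialD {d : ℕ} (i : Fin d) (φ : E d → ℝ) (x : E d) : ℝ :=
  fderiv ℝ φ x (EuclideanSpace.single i 1)

/-- Test functions `C_c^∞(O)`. -/
def IsTest {d : ℕ} (O : Set (E d)) (φ : E d → ℝ) : Prop :=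
  ContDiff ℝ ∞ φ ∧ HasCompactSupport φ ∧ tsupport φ ⊆ O

/-- `g` is the weak partial derivative `∂v/∂x_i` in the open set `O`. -/
def HasWeakDeriv {d : ℕ} (O : Set (E d)) (i : Fin d) (v g : E d → ℝ) : Prop :=
  LocallyIntegrableOn v O ∧ LocallyIntegrableOn g O ∧
    ∀ φ : E d → ℝ, IsTest O φ →
      ∫ x in O, v x * partialD i φ x = -∫ x in O, g x * φ x

open Classical in
/-- The weak partial derivative (unique up to null sets when it exists; `0` when it does not). -/
def weakDeriv {d : ℕ} (O : Set (E d)) (i : Fin d) (v : E d → ℝ) : E d → ℝ :=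
  if h : ∃ g, HasWeakDeriv O i v g then h.choose else 0

/-- `v ∈ H¹(O)`. -/
def MemH1 {d : ℕ} (O : Set (E d)) (v : E d → ℝ) : Prop :=
  MemLp v 2 (volume.restrict O) ∧
    ∀ i, HasWeakDeriv O i v (weakDeriv O i v) ∧
      MemLp (weakDeriv O i v) 2 (volume.restrict O)

/-- `g ∈ L²(∂O)` is the trace of `v ∈ H¹(O)`, where `σ` is the surface measure of `∂O`.  The trace
operator is the continuous extension of the restriction of functions smooth up to the boundary:
smooth functions converge to `v` in `H¹(O)` while their boundary values converge to `g`. -/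
def HasTrace {d : ℕ} (O : Set (E d)) (σ : Measure (E d)) (v g : E d → ℝ) : Prop :=
  MemLp g 2 σ ∧
  ∃ φ : ℕ → E d → ℝ, (∀ n, ContDiff ℝ ∞ (φ n)) ∧
    Tendsto (fun n => eLpNorm (fun x => φ n x - v x) 2 (volume.restrict O)) atTop (𝓝 0) ∧
    (∀ i, Tendsto (fun n => eLpNorm (fun x => partialD i (φ n) x - weakDeriv O i v x) 2
      (volume.restrict O)) atTop (𝓝 0)) ∧
    Tendsto (fun n => eLpNorm (fun x => φ n x - g x) 2 σ) atTop (𝓝 0)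

/-! ### Polynomials and polynomial projections -/

/-- `ℙ_n` in `d` variables, for an integer `n`; it is `{0}` for negative `n`. -/
def polyLE (d : ℕ) (n : ℤ) : Submodule ℝ (MvPolynomial (Fin d) ℝ) :=
  MvPolynomial.restrictSupport ℝ {s | (s.degree : ℤ) ≤ n}

/-- The polynomials of `ℙ_n` all of whose monomials have degree strictly greater than `m`. -/
def polyHat (d : ℕ) (n m : ℤ) : Submodule ℝ (MvPolynomial (Fin d) ℝ) :=
  MvPolynomial.restrictSupport ℝ {s | m < (s.degree : ℤ) ∧ (s.degree : ℤ) ≤ n}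

/-- The value of a polynomial at a point. -/
def ev {d : ℕ} (p : MvPolynomial (Fin d) ℝ) (x : E d) : ℝ :=
  MvPolynomial.eval (fun i => x i) p

/-- `p` is the `L²`-projection of `v` on `ℙ_n(O)`. -/
def IsL2Proj {d : ℕ} (O : Set (E d)) (n : ℤ) (v : E d → ℝ) (p : MvPolynomial (Fin d) ℝ) : Prop :=
  p ∈ polyLE d n ∧ ∀ q ∈ polyLE d n, ∫ x in O, ev q x * (v x - ev p x) = 0

/-- `p` is the `H¹`-seminorm projection of `v` on `ℙ_n(O)`; `σ` is the surface measure of `∂O`, and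
the values of `v` on `∂O` are those of its trace. -/
def IsNablaProj {d : ℕ} (O : Set (E d)) (σ : Measure (E d)) (n : ℤ) (v : E d → ℝ)
    (p : MvPolynomial (Fin d) ℝ) : Prop :=
  p ∈ polyLE d n ∧
  (∀ q ∈ polyLE d n,
    ∫ x in O, ∑ i, ev (MvPolynomial.pderiv i q) x *
      (weakDeriv O i v x - ev (MvPolynomial.pderiv i p) x) = 0) ∧
  ∫ x, (v x - ev p x) ∂σ = 0

/-! ### Polyhedra -/

/-- The length measure of the segment from `a` to `b`. -/
def segMeasure {d : ℕ} (a b : E d) : Measure (E d) :=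
  ENNReal.ofReal ‖b - a‖ •
    (volume.restrict (Icc (0 : ℝ) 1)).map (fun t : ℝ => AffineMap.lineMap a b t)

/-- The orthonormal frame `(n, τ₁, τ₂)` attached to an isometric parametrization of a plane:
`τ₁`, `τ₂` are the images of the coordinate directions and `n = τ₁ ∧ τ₂`. -/
def planeFrame (A : E 2 →ᵃⁱ[ℝ] E 3) : Fin 3 → E 3 :=
  let τ₁ := A.linearIsometry (EuclideanSpace.single 0 1)
  let τ₂ := A.linearIsometry (EuclideanSpace.single 1 1)
  ![WithLp.toLp 2 (crossProduct τ₁.ofLp τ₂.ofLp), τ₁, τ₂]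

/-- The local coordinates, with respect to the frame, of (the orthogonal projection on the plane
of) a point of the space. -/
def planeCoord (A : E 2 →ᵃⁱ[ℝ] E 3) (y : E 3) : E 2 :=
  !₂[inner ℝ (planeFrame A 1) (y - A 0), inner ℝ (planeFrame A 2) (y - A 0)]

/-- A bounded open polyhedron with its vertices, (straight) edges and (planar) faces.  Every face
carries a local orthonormal coordinate system `chart f` of its plane, and `region f` is the
relatively open face in these coordinates.  Adjacent faces may be coplanar and adjacent edges
collinear. -/
structure Polyhedron where
  /-- the interior of the polyhedron -/
  carrier : Set (E 3)
  isOpen : IsOpen carrier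
  isBounded : Bornology.IsBounded carrier
  isConnected : IsConnected carrier
  /-- numbers of vertices, edges and faces -/
  nV : ℕ
  nE : ℕ
  nF : ℕ
  /-- the position of a vertex -/
  pt : Fin nV → E 3
  pt_injective : Function.Injective pt
  /-- the two endpoints of an edge -/
  src : Fin nE → Fin nV
  tgt : Fin nE → Fin nV
  src_ne_tgt : ∀ e, src e ≠ tgt e
  chart : Fin nF → (E 2 →ᵃⁱ[ℝ] E 3)
  region : Fin nF → Set (E 2)
  region_isOpen : ∀ f, IsOpen (region f)
  region_isBounded : ∀ f, Bornology.IsBounded (region f)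
  region_isConnected : ∀ f, IsConnected (region f)
  /-- the edges of a face -/
  bdry : Fin nF → Finset (Fin nE)
  frontier_carrier : frontier carrier = ⋃ f, chart f '' closure (region f)
  frontier_region : ∀ f,
    chart f '' frontier (region f) = ⋃ e ∈ bdry f, segment ℝ (pt (src e)) (pt (tgt e))
  /-- a relatively open face does not meet the other closed faces -/
  faces_disjoint : ∀ f g, f ≠ g →
    Disjoint (chart f '' region f) (chart g '' closure (region g))
  /-- distinct edges meet at most in common endpoints -/
  edges_inter : ∀ e e', e ≠ e' →
    segment ℝ (pt (src e)) (pt (tgt e)) ∩ segment ℝ (pt (src e')) (pt (tgt e')) ⊆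
      {pt (src e), pt (tgt e)} ∩ {pt (src e'), pt (tgt e')}
  edge_mem_face : ∀ e, ∃ f, e ∈ bdry f
  vertex_mem_edge : ∀ ν, ∃ e, ν = src e ∨ ν = tgt e
  /-- the normal of every face is the outward one -/
  outward : ∀ f, ∀ y ∈ region f, ∀ᶠ t in 𝓝[>] (0 : ℝ),
    chart f y - t • planeFrame (chart f) 0 ∈ carrier ∧
      chart f y + t • planeFrame (chart f) 0 ∉ closure carrier

/-- `s` is star-shaped with respect to a ball of radius `≥ r₀`. -/
def StarShapedBall {d : ℕ} (s : Set (E d)) (r₀ : ℝ) : Prop :=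
  ∃ c r, r₀ ≤ r ∧ ∀ b ∈ Metric.ball c r, StarConvex ℝ b s

namespace Polyhedron

variable (P : Polyhedron)

/-- The diameter `h_P`. -/
def diam : ℝ := Metric.diam P.carrier

/-- The mesh assumptions with constant `ρ`: the element is star-shaped with respect to a ball of
radius `≥ ρ h_P`, every face is star-shaped with respect to a disk of radius `≥ ρ h_P`, and every
edge has length `≥ ρ h_P`.  (A star-shaped element is contractible.) -/
structure ShapeRegular (ρ : ℝ) : Prop where
  element : StarShapedBall P.carrier (ρ * P.diam)
  face : ∀ f, StarShapedBall (P.region f) (ρ * P.diam)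
  edge : ∀ e, ρ * P.diam ≤ dist (P.pt (P.src e)) (P.pt (P.tgt e))

/-- The point with parameter `t ∈ [0,1]` of an edge. -/
def edgePt (e : Fin P.nE) (t : ℝ) : E 3 :=
  AffineMap.lineMap (P.pt (P.src e)) (P.pt (P.tgt e)) t

/-- The surface measure of `∂P`. -/
def surf : Measure (E 3) := ∑ f, (volume.restrict (P.region f)).map (P.chart f)

/-- The length measure of `∂f`, in the local coordinates of the face `f`. -/
def faceBdry (f : Fin P.nF) : Measure (E 2) :=
  ∑ e ∈ P.bdry f, segMeasure (planeCoord (P.chart f) (P.pt (P.src e)))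
    (planeCoord (P.chart f) (P.pt (P.tgt e)))

/-- The restriction to the face `f` of a component of a vector field, in local coordinates. -/
def onFace (f : Fin P.nF) (v : E 3 → E 3) (i : Fin 3) (y : E 2) : ℝ := v (P.chart f y) i

/-! ### The virtual element spaces

An element of `H¹` is represented by a function whose values on the boundary are those of its trace
(every class in `H¹` has such a representative, the boundary being a null set). -/

/-- The face space `B̂_k(f)`. -/
def faceSpace (k : ℕ) (f : Fin P.nF) : Set (E 2 → ℝ) :=
  {w | MemH1 (P.region f) w ∧ HasTrace (P.region f) (P.faceBdry f) w w ∧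
    ContinuousOn w (frontier (P.region f)) ∧
    (∀ e ∈ P.bdry f, ∃ q : Polynomial ℝ, q.natDegree ≤ k ∧
      ∀ t ∈ Icc (0 : ℝ) 1, w (planeCoord (P.chart f) (P.edgePt e t)) = q.eval t) ∧
    (∃ p ∈ polyLE 2 (k + 1), ∀ φ, IsTest (P.region f) φ →
      -∫ y in P.region f, ∑ i, weakDeriv (P.region f) i w y * partialD i φ y =
        ∫ y in P.region f, ev p y * φ y) ∧
    ∃ π, IsNablaProj (P.region f) (P.faceBdry f) k w π ∧
      ∀ p ∈ polyHat 2 (k + 1) (k - 2), ∫ y in P.region f, (w y - ev π y) * ev p y = 0}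

/-- The polynomial vector field `x ∧ p`. -/
def xWedge (p : Fin 3 → MvPolynomial (Fin 3) ℝ) (x : E 3) : Fin 3 → ℝ :=
  crossProduct x.ofLp (fun i => ev (p i) x)

/-- The weak divergence in `P`. -/
def divP (v : E 3 → E 3) (x : E 3) : ℝ :=
  ∑ i, weakDeriv P.carrier i (fun y => v y i) x

/-- The virtual element space `V_h(P)`. -/
def space (k : ℕ) : Set (E 3 → E 3) :=
  {v | (∀ i, MemH1 P.carrier (fun x => v x i) ∧
      HasTrace P.carrier P.surf (fun x => v x i) (fun x => v x i)) ∧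
    ContinuousOn v (frontier P.carrier) ∧
    (∀ f i, P.onFace f v i ∈ P.faceSpace k f) ∧
    -- `Δ v + ∇ s ∈ x ∧ [ℙ_{k-1}]³` in the sense of distributions
    (∃ s : E 3 → ℝ, MemLp s 2 (volume.restrict P.carrier) ∧ ∫ x in P.carrier, s x = 0 ∧
      ∃ p : Fin 3 → MvPolynomial (Fin 3) ℝ, (∀ i, p i ∈ polyLE 3 (k - 1)) ∧
        ∀ i, ∀ φ, IsTest P.carrier φ →
          (-∫ x in P.carrier, ∑ j, weakDeriv P.carrier j (fun y => v y i) x * partialD j φ x)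
            - ∫ x in P.carrier, s x * partialD i φ x =
          ∫ x in P.carrier, xWedge p x i * φ x) ∧
    (∃ q ∈ polyLE 3 (k - 1), ∀ᵐ x ∂volume.restrict P.carrier, P.divP v x = ev q x) ∧
    ∃ π : Fin 3 → MvPolynomial (Fin 3) ℝ,
      (∀ i, IsNablaProj P.carrier P.surf k (fun x => v x i) (π i)) ∧
      ∀ p : Fin 3 → MvPolynomial (Fin 3) ℝ, (∀ i, p i ∈ polyHat 3 (k - 1) (k - 3)) →
        ∫ x in P.carrier, ∑ i, (v x i - ev (π i) x) * xWedge p x i = 0}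

/-! ### The degrees of freedom -/

/-- The labels of the degrees of freedom `D_V`. -/
inductive DofIndex (k : ℕ)
  /-- the components of the value at a vertex -/
  | vertex (ν : Fin P.nV) (i : Fin 3)
  /-- the components of the value at the `k - 1` points of an edge -/
  | edge (e : Fin P.nE) (j : Fin (k - 1)) (i : Fin 3)
  /-- the face moments of the components along `n`, `τ₁`, `τ₂` -/
  | face (f : Fin P.nF) (c : Fin 3) (p : polyLE 2 ((k : ℤ) - 2))
  /-- the volume moments against `x ∧ p` -/
  | volume (p : Fin 3 → polyLE 3 ((k : ℤ) - 3))
  /-- the volume moments of the divergence -/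
  | div (p : polyHat 3 ((k : ℤ) - 1) 0)

/-- The degrees of freedom; `t e j` is the parameter of the `j`-th point of the edge `e`. -/
def dof (k : ℕ) (t : Fin P.nE → Fin (k - 1) → ℝ) (v : E 3 → E 3) : P.DofIndex k → ℝ
  | .vertex ν i => v (P.pt ν) i
  | .edge e j i => v (P.edgePt e (t e j)) i
  | .face f c p => ∫ y in P.region f,
      inner ℝ (v (P.chart f y)) (planeFrame (P.chart f) c) * ev p.1 y
  | .volume p => ∫ x in P.carrier, ∑ i, v x i * xWedge (fun j => (p j).1) x i
  | .div p => ∫ x in P.carrier, P.divP v x * ev p.1 x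

/-- A quantity `m ∈ M` attached to the elements `v` of `V_h(P)` through the relation `R v m` is
computable from the degrees of freedom: there are finitely many of them and coefficients in `M`
for these, which do not depend on `v`, such that the only `m` with `R v m` is the linear combination
of the values for `v` of these degrees of freedom with these coefficients. -/
def Computable (k : ℕ) (t : Fin P.nE → Fin (k - 1) → ℝ) {M : Type*} [AddCommGroup M] [Module ℝ M]
    (R : (E 3 → E 3) → M → Prop) : Prop :=
  ∃ c : P.DofIndex k →₀ M, ∀ v ∈ P.space k, ∀ m : M,
    R v m ↔ m = c.sum fun j a => P.dof k t v j • a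

end Polyhedron

end VEM

end

/-! Every projection in the statement solves a finite linear system with a nondegenerate polynomial
matrix. Its right-hand side consists of moments of `v`, or of its weak derivatives, against
polynomials, plus boundary integrals for the `H¹`-seminorm projections. By `computable_of_bilin`,
specialised in `computable_l2Proj` and `computable_nablaProj`, it suffices that these right-hand
sides lie in `dofSpan`, the span of the degrees of freedom.

On a face, `v` restricted to an edge is a polynomial of degree at most `k`, hence known from its `k
+ 1` nodal values. In Green's formula `∫ ∇w·∇q = boundary - ∫ w Δq` the Laplacian has degree at most
`k - 2`, so the face moments give `Π_k^{∇,f}`. The orthogonality built into the face space then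
raises the known moments from degree `k - 2` to `k + 1` (`face_moment_mem_dofSpan`). This gives
`Π_{k+1}^{0,f}` and all boundary terms needed in the element.

In the element, `div v` is a polynomial of degree at most `k - 1`. Its mean is a boundary flux and
its other moments are degrees of freedom, so it is known, and with it `∫ v·∇φ` for `φ` of degree at
most `k + 1`. Every polynomial field of degree `n` is `∇φ + x ∧ p` with `p` of degree `n - 1`
(`exists_grad_add_wedge`), so the moments of the components of `v` reduce to moments against `x ∧
p`. The degrees of freedom give these for `n = k - 2`, which suffices for `Π_k^{∇,P}`; the
orthogonality in the element space then reaches `n = k` (`moment_mem_dofSpan`). One more integration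
by parts yields the gradients.

Green's formula itself is obtained by cutting a star-shaped set into cones over its flat boundary
pieces (`StarPieces.exists_integral_fderiv_eq`) and passing to the limit in smooth approximations
(`HasTrace.green`). The boundary coefficients are only needed to be constants independent of the
function. -/

noncomputable section

open scoped Pointwise

namespace VEM

/-! ### The divergence theorem in star-shaped sets with piecewise flat boundary. -/

section Cone

variable {X F : Type*} [NormedAddCommGroup X] [NormedSpace ℝ X]
  [NormedAddCommGroup F] [NormedSpace ℝ F]

/-- Replace `y` by a nearby `y' ∈ O` and compensate by moving the apex to `b'` so that the point at
parameter `s` is unchanged. The apex has room to move because it lies in an open ball of star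
centres. -/
theorem cone_mem_of_starConvex {O : Set X} {c : X} {r : ℝ}
    (hstar : ∀ b ∈ Metric.ball c r, StarConvex ℝ b O) {b : X} (hb : b ∈ Metric.ball c r) {y : X}
    (hy : y ∈ closure O) {s : ℝ} (hs : 0 ≤ s) (hs1 : s < 1) : b + s • (y - b) ∈ O := by
  have hb' : 0 < r - dist b c := sub_pos.2 hb
  have h1 : 0 < 1 - s := sub_pos.2 hs1
  -- This tolerance keeps the displacement `s / (1 - s) • (y - y')` of the apex shorter than its
  -- distance to the sphere of radius `r`.
  obtain ⟨y', hy', hd⟩ := Metric.mem_closure_iff.1 hy ((r - dist b c) * (1 - s)) (by positivity)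
  set b' := b + (s / (1 - s)) • (y - y') with hb'_def
  have hbb : b' ∈ Metric.ball c r := by
    have h2 : dist b' b < r - dist b c := by
      rw [hb'_def, dist_self_add_left, norm_smul, Real.norm_of_nonneg (by positivity),
        ← dist_eq_norm]
      calc s / (1 - s) * dist y y' ≤ s / (1 - s) * ((r - dist b c) * (1 - s)) := by gcongr
        _ = s * (r - dist b c) := by field_simp
        _ < r - dist b c := by nlinarith
    rw [Metric.mem_ball]
    linarith [dist_triangle b' b c]
  have := hstar b' hbb hy' h1.le hs (by ring)
  convert this using 1
  rw [hb'_def, smul_add, smul_smul, mul_div_cancel₀ _ h1.ne']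
  module

/-- Continued beyond `x`, the ray from `b` leaves the bounded set, and by connectedness it meets the
frontier on the way out. -/
theorem exists_frontier_ray {O : Set X} (hO : IsOpen O) (hbd : Bornology.IsBounded O) {b x : X}
    (hx : x ∈ O) (hxb : x ≠ b) :
    ∃ y ∈ frontier O, ∃ s ∈ Ioo (0 : ℝ) 1, x = b + s • (y - b) := by
  obtain ⟨R, hR⟩ := hbd.subset_ball b
  have hR0 : 0 < R := Metric.pos_of_mem_ball (hR hx)
  have hn : 0 < ‖x - b‖ := norm_pos_iff.2 (sub_ne_zero.2 hxb)
  set γ : ℝ → X := fun τ => b + τ • (x - b) with hγ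
  have hγc : Continuous γ := by fun_prop
  set τ₁ := max 1 (R / ‖x - b‖)
  have hpre : IsPreconnected (γ '' Icc 1 τ₁) := isPreconnected_Icc.image _ hγc.continuousOn
  have hγ1 : γ 1 = x := by simp [hγ]
  have hout : γ τ₁ ∉ O := fun h => by
    have h1 := hR h
    rw [Metric.mem_ball, hγ, dist_self_add_left, norm_smul,
      Real.norm_of_nonneg (le_trans zero_le_one (le_max_left _ _))] at h1
    have h2 : R / ‖x - b‖ ≤ τ₁ := le_max_right _ _
    rw [div_le_iff₀ hn] at h2
    linarith
  have hne : (γ '' Icc 1 τ₁ ∩ frontier O).Nonempty := by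
    by_contra hcon
    rw [not_nonempty_iff_eq_empty] at hcon
    have hsub : γ '' Icc 1 τ₁ ⊆ O ∪ (closure O)ᶜ := by
      intro z hz
      by_contra hz'
      simp only [mem_union, mem_compl_iff, not_or, not_not] at hz'
      have : z ∈ γ '' Icc 1 τ₁ ∩ frontier O := ⟨hz, by
        rw [hO.frontier_eq]; exact ⟨hz'.2, hz'.1⟩⟩
      rw [hcon] at this
      exact this
    have h1 := hpre.subset_left_of_subset_union hO isClosed_closure.isOpen_compl
      (disjoint_compl_right_iff_subset.2 subset_closure) hsub
      ⟨x, ⟨1, ⟨le_rfl, le_max_left _ _⟩, hγ1⟩, hx⟩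
    exact hout (h1 ⟨τ₁, ⟨le_max_left _ _, le_rfl⟩, rfl⟩)
  obtain ⟨y, ⟨τ, hτ, rfl⟩, hy⟩ := hne
  have hτ1 : 1 < τ := by
    refine lt_of_le_of_ne hτ.1 ?_
    rintro rfl
    rw [hγ1, hO.frontier_eq] at hy
    exact hy.2 hx
  refine ⟨_, hy, τ⁻¹, ⟨by positivity, inv_lt_one_of_one_lt₀ hτ1⟩, ?_⟩
  rw [hγ]
  simp only [add_sub_cancel_left, smul_smul]
  rw [inv_mul_cancel₀ (by positivity), one_smul, add_sub_cancel]

/-- Of two distinct frontier points on one ray the nearer would be interior by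
`cone_mem_of_starConvex`. Hence cones over disjoint boundary pieces are disjoint. -/
theorem ray_frontier_inj {O : Set X} (hO : IsOpen O) {c : X} {r : ℝ}
    (hstar : ∀ b ∈ Metric.ball c r, StarConvex ℝ b O) {b : X} (hb : b ∈ Metric.ball c r) {y y' : X}
    (hy : y ∈ frontier O) (hy' : y' ∈ frontier O) {s s' : ℝ} (hs : 0 < s) (hs' : 0 < s')
    (h : b + s • (y - b) = b + s' • (y' - b)) : s = s' ∧ y = y' := by
  have key : ∀ {y y' : X} {s s' : ℝ}, y ∈ frontier O → y' ∈ frontier O → 0 < s → 0 < s' →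
      b + s • (y - b) = b + s' • (y' - b) → ¬ s < s' := by
    intro y y' s s' hy hy' hs hs' h hlt
    have h1 : y' = b + (s / s') • (y - b) := by
      have h2 : s • (y - b) = s' • (y' - b) := add_left_cancel h
      rw [div_eq_inv_mul, mul_smul, h2, smul_smul, inv_mul_cancel₀ hs'.ne', one_smul,
        add_sub_cancel]
    have h3 := cone_mem_of_starConvex hstar hb (frontier_subset_closure hy)
      (div_nonneg hs.le hs'.le) ((div_lt_one hs').2 hlt)
    rw [← h1] at h3
    rw [hO.frontier_eq] at hy'
    exact hy'.2 h3
  have hss : s = s' := le_antisymm (not_lt.1 (key hy' hy hs' hs h.symm)) (not_lt.1 (key hy hy' hs hs' h))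
  refine ⟨hss, ?_⟩
  subst hss
  have h2 : s • (y - b) = s • (y' - b) := add_left_cancel h
  exact sub_left_injective (smul_right_injective X hs.ne' h2)

/-- The linear map `(s, y) ↦ s (A 0 - b) + A_lin y` which parametrizes the cone with apex `b` over
the range of the affine map `A`. -/
def coneMap (A : F →ᵃ[ℝ] X) (b : X) : ℝ × F →ₗ[ℝ] X :=
  (LinearMap.toSpanSingleton ℝ X (A 0 - b)).coprod A.linear

theorem coneMap_apply (A : F →ᵃ[ℝ] X) (b : X) (s : ℝ) (y : F) :
    coneMap A b (s, y) = s • (A 0 - b) + A.linear y := by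
  simp [coneMap]

theorem affine_eq_linear_add (A : F →ᵃ[ℝ] X) (y : F) : A y = A.linear y + A 0 := by
  have := A.map_vadd 0 y
  simpa using this

theorem coneMap_smul (A : F →ᵃ[ℝ] X) (b : X) (s : ℝ) (y : F) :
    coneMap A b (s, s • y) = s • (A y - b) := by
  rw [coneMap_apply, affine_eq_linear_add A y, map_smul]
  module

/-- A kernel element with `s ≠ 0` would put the apex in the plane of the piece. Moving a point of
the piece slightly towards the apex would then remain in the frontier, yet enter the open set. -/
theorem coneMap_injective {O : Set X} (hO : IsOpen O) {c : X} {r : ℝ}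
    (hstar : ∀ b ∈ Metric.ball c r, StarConvex ℝ b O) {b : X} (hb : b ∈ Metric.ball c r)
    {A : F →ᵃ[ℝ] X} (hA : Function.Injective A) {R : Set F} (hR : IsOpen R) (hne : R.Nonempty)
    (hRO : A '' R ⊆ frontier O) : Function.Injective (coneMap A b) := by
  rw [injective_iff_map_eq_zero]
  rintro ⟨s, w⟩ h
  rw [coneMap_apply] at h
  have hAl : Function.Injective A.linear := A.linear_injective_iff.2 hA
  by_cases hs : s = 0
  · subst hs
    rw [zero_smul, zero_add] at h
    rw [(map_eq_zero_iff _ hAl).1 h, Prod.mk_zero_zero]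
  exfalso
  obtain ⟨y, hy⟩ := hne
  have hw : A (s⁻¹ • w) = b := by
    rw [affine_eq_linear_add, map_smul, eq_neg_of_add_eq_zero_right h, smul_neg, smul_smul,
      inv_mul_cancel₀ hs]
    module
  set w' := s⁻¹ • w
  have hcont : ContinuousAt (fun τ : ℝ => y + τ • (w' - y)) 0 := by fun_prop
  have hev : ∀ᶠ τ in 𝓝 (0 : ℝ), y + τ • (w' - y) ∈ R :=
    hcont (hR.mem_nhds (by simpa using hy))
  have hev' : ∀ᶠ τ in 𝓝[>] (0 : ℝ), y + τ • (w' - y) ∈ R ∧ τ ∈ Ioo (0 : ℝ) 1 :=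
    (hev.filter_mono nhdsWithin_le_nhds).and (Ioo_mem_nhdsGT zero_lt_one)
  obtain ⟨τ, hτ, hτ0, hτ1⟩ := hev'.exists
  have h1 : A (y + τ • (w' - y)) ∈ frontier O := hRO ⟨_, hτ, rfl⟩
  have h2 : A y ∈ frontier O := hRO ⟨_, hy, rfl⟩
  have h3 := cone_mem_of_starConvex hstar hb (frontier_subset_closure h2)
    (s := 1 - τ) (by linarith) (by linarith)
  rw [hO.frontier_eq] at h1
  refine h1.2 ?_
  convert h3 using 1
  rw [← hw, affine_eq_linear_add A (y + _), affine_eq_linear_add A y, affine_eq_linear_add A w']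
  simp only [map_add, map_smul, map_sub]
  module

/-- The cone `{(s, z) : 0 < s < 1, z ∈ s R}`. -/
def stdCone (R : Set F) : Set (ℝ × F) := {z | z.1 ∈ Ioo (0 : ℝ) 1 ∧ z.1⁻¹ • z.2 ∈ R}

theorem mem_cone_iff {A : F →ᵃ[ℝ] X} {R : Set F} {b x : X} :
    x ∈ (fun z => b + coneMap A b z) '' stdCone R ↔
      ∃ y ∈ R, ∃ s ∈ Ioo (0 : ℝ) 1, x = b + s • (A y - b) := by
  constructor
  · rintro ⟨⟨s, z⟩, ⟨hs, hz⟩, rfl⟩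
    refine ⟨_, hz, s, hs, ?_⟩
    rw [← coneMap_smul, smul_smul, mul_inv_cancel₀ hs.1.ne', one_smul]
  · rintro ⟨y, hy, s, hs, rfl⟩
    refine ⟨(s, s • y), ⟨hs, ?_⟩, ?_⟩
    · rwa [smul_smul, inv_mul_cancel₀ (ne_of_gt hs.1), one_smul]
    · simp only [coneMap_smul]

theorem isOpen_stdCone {R : Set F} (hR : IsOpen R) : IsOpen (stdCone R) := by
  have h1 : IsOpen {z : ℝ × F | z.1 ∈ Ioo (0 : ℝ) 1} := isOpen_Ioo.preimage continuous_fst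
  have h2 : ContinuousOn (fun z : ℝ × F => z.1⁻¹ • z.2) {z : ℝ × F | z.1 ∈ Ioo (0 : ℝ) 1} :=
    (continuousOn_fst.inv₀ fun z hz => (ne_of_gt hz.1)).smul continuousOn_snd
  exact h2.isOpen_inter_preimage h1 hR

theorem isBounded_stdCone {R : Set F} (hR : Bornology.IsBounded R) :
    Bornology.IsBounded (stdCone R) := by
  obtain ⟨M, hM⟩ := hR.subset_closedBall 0
  refine ((Metric.isBounded_Ioo (0 : ℝ) 1).prod
    (Metric.isBounded_closedBall (x := (0 : F)) (r := M))).subset ?_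
  rintro ⟨s, z⟩ ⟨hs, hz⟩
  refine ⟨hs, ?_⟩
  have h1 := hM hz
  simp only [mem_closedBall_zero_iff, norm_smul, norm_inv, Real.norm_of_nonneg hs.1.le] at h1 ⊢
  rw [inv_mul_le_iff₀ hs.1] at h1
  nlinarith [hs.2, hs.1, norm_nonneg z]

theorem _root_.Continuous.integrableOn_of_isBounded {X : Type*} [MetricSpace X]
    [ProperSpace X] [MeasurableSpace X] [BorelSpace X] {μ : Measure X} [IsFiniteMeasureOnCompacts μ]
    {g : X → ℝ} (hg : Continuous g) {s : Set X} (hs : Bornology.IsBounded s) :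
    IntegrableOn g s μ :=
  (hg.continuousOn.integrableOn_compact hs.isCompact_closure).mono_set subset_closure

variable [MeasurableSpace X] [BorelSpace X] [FiniteDimensional ℝ X] (μ : Measure X)
  [μ.IsAddHaarMeasure]

/-- An open bounded set `O`, star-shaped with respect to the ball `B(c, r)`, whose boundary is the
disjoint union of the flat pieces `A j '' R j` up to a set `N` which subtends null cones. -/
structure StarPieces {ι : Type*} (O : Set X) (c : X) (r : ℝ) (J : Finset ι) (A : ι → F →ᵃ[ℝ] X)
    (R : ι → Set F) (N : Set X) : Prop where
  isOpen : IsOpen O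
  isBounded : Bornology.IsBounded O
  nonempty : O.Nonempty
  pos : 0 < r
  star : ∀ b ∈ Metric.ball c r, StarConvex ℝ b O
  injective : ∀ j ∈ J, Function.Injective (A j)
  isOpen_piece : ∀ j ∈ J, IsOpen (R j)
  isBounded_piece : ∀ j ∈ J, Bornology.IsBounded (R j)
  frontier_subset : frontier O ⊆ (⋃ j ∈ J, A j '' R j) ∪ N
  piece_subset : ∀ j ∈ J, A j '' R j ⊆ frontier O
  disjoint : ∀ i ∈ J, ∀ j ∈ J, i ≠ j → Disjoint (A i '' R i) (A j '' R j)
  null : ∀ b, μ {x | ∃ y ∈ N, ∃ s : ℝ, x = b + s • (y - b)} = 0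

variable {μ} {ι : Type*} {O : Set X} {c : X} {r : ℝ} {J : Finset ι} {A : ι → F →ᵃ[ℝ] X}
    {R : ι → Set F} {N : Set X}

/-- Only the apex and the cones over `N` escape the cones over the flat pieces, and both are null.
-/
theorem StarPieces.ae_eq [Nontrivial X] (h : StarPieces μ O c r J A R N) {b : X}
    (hb : b ∈ Metric.ball c r) :
    O =ᵐ[μ] ⋃ j ∈ J, (fun z => b + coneMap (A j) b z) '' stdCone (R j) := by
  have hsub : (⋃ j ∈ J, (fun z => b + coneMap (A j) b z) '' stdCone (R j)) ⊆ O := by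
    refine iUnion₂_subset fun j hj x hx => ?_
    obtain ⟨y, hy, s, hs, rfl⟩ := mem_cone_iff.1 hx
    exact cone_mem_of_starConvex h.star hb
      (frontier_subset_closure (h.piece_subset j hj ⟨y, hy, rfl⟩)) hs.1.le hs.2
  refine (ae_eq_set.2 ⟨measure_mono_null ?_ (measure_union_null (h.null b)
    (measure_singleton b)), ?_⟩)
  · rintro x ⟨hxO, hx⟩
    by_cases hxb : x = b
    · exact Or.inr hxb
    left
    obtain ⟨y, hy, s, hs, rfl⟩ := exists_frontier_ray h.isOpen h.isBounded hxO hxb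
    rcases h.frontier_subset hy with hy' | hy'
    · exfalso
      obtain ⟨j, hj, z, hz, rfl⟩ := mem_iUnion₂.1 hy'
      exact hx (mem_iUnion₂.2 ⟨j, hj, mem_cone_iff.2 ⟨z, hz, s, hs, rfl⟩⟩)
    · exact ⟨y, hy', s, rfl⟩
  · rw [sdiff_eq_empty.2 hsub, measure_empty]

variable [MeasurableSpace F] [BorelSpace F] [FiniteDimensional ℝ F] (ν : Measure F) [ν.IsAddHaarMeasure]

/-- Fubini in the height `s`, followed by rescaling the slice `s • R` to `R`, which produces the
power of `s`. -/
theorem integral_stdCone {R : Set F} (hR : IsOpen R) (hRb : Bornology.IsBounded R)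
    {G : ℝ × F → ℝ} (hG : Continuous G) :
    ∫ z in stdCone R, G z ∂(volume.prod ν) =
      ∫ s in Ioo (0 : ℝ) 1, ∫ y in R, s ^ Module.finrank ℝ F * G (s, s • y) ∂ν := by
  have : ProperSpace F := FiniteDimensional.proper ℝ F
  have hint : IntegrableOn G (stdCone R) (volume.prod ν) :=
    hG.integrableOn_of_isBounded (isBounded_stdCone hRb)
  have hm : MeasurableSet (stdCone R) := (isOpen_stdCone hR).measurableSet
  rw [← integral_indicator hm, integral_prod _ ((integrable_indicator_iff hm).2 hint),
    ← integral_indicator measurableSet_Ioo]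
  congr 1
  ext s
  by_cases hs : s ∈ Ioo (0 : ℝ) 1
  · rw [indicator_of_mem hs, integral_const_mul,
      Measure.setIntegral_comp_smul_of_pos ν (fun z => G (s, z)) R hs.1,
      smul_eq_mul, mul_inv_cancel_left₀ (pow_pos hs.1 _).ne',
      ← integral_indicator (hR.smul₀ hs.1.ne').measurableSet]
    congr 1
    ext z
    have : (s, z) ∈ stdCone R ↔ z ∈ s • R := by
      rw [mem_smul_set_iff_inv_smul_mem₀ hs.1.ne']
      exact ⟨fun h => h.2, fun h => ⟨hs, h⟩⟩
    by_cases hz : z ∈ s • R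
    · rw [indicator_of_mem (this.2 hz), indicator_of_mem hz]
    · rw [indicator_of_notMem (mt this.1 hz), indicator_of_notMem hz]
  · rw [indicator_of_notMem hs]
    have : ∀ z, (stdCone R).indicator G (s, z) = 0 := fun z =>
      indicator_of_notMem (fun h => hs h.1) _
    simp [this]

variable (μ) in
-- By uniqueness of Haar measure, `μ` is a multiple of the image of the product measure under a
-- linear isomorphism. The factor never has to be computed as a determinant.
theorem exists_integral_image_eq (hdim : Module.finrank ℝ X = Module.finrank ℝ F + 1)
    {T : ℝ × F →ₗ[ℝ] X} (hT : Function.Injective T) (b : X) :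
    ∃ κ : ℝ, ∀ (K : Set (ℝ × F)) (g : X → ℝ),
      ∫ x in (fun z => b + T z) '' K, g x ∂μ = κ * ∫ z in K, g (b + T z) ∂(volume.prod ν) := by
  have hfin : Module.finrank ℝ (ℝ × F) = Module.finrank ℝ X := by
    rw [Module.finrank_prod, Module.finrank_self, hdim, add_comm]
  let e : (ℝ × F) ≃L[ℝ] X := (LinearEquiv.ofInjectiveOfFinrankEq T hT hfin).toContinuousLinearEquiv
  have he : ∀ z, e z = T z := fun z => rfl
  have := e.isAddHaarMeasure_map (volume.prod ν)
  have hμ := Measure.isAddLeftInvariant_eq_smul μ (Measure.map e (volume.prod ν))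
  set κ := Measure.addHaarScalarFactor μ (Measure.map e (volume.prod ν))
  refine ⟨κ, fun K g => ?_⟩
  have himg : (fun z => b + T z) '' K = (fun x => -b + x) ⁻¹' (T '' K) := by
    ext x
    constructor
    · rintro ⟨z, hz, rfl⟩
      exact ⟨z, hz, by simp⟩
    · rintro ⟨z, hz, h⟩
      exact ⟨z, hz, by simp [h]⟩
  have hmp : MeasurePreserving (fun x => -b + x) μ μ := measurePreserving_add_left μ (-b)
  have h1 := hmp.setIntegral_preimage_emb (measurableEmbedding_addLeft (-b))
    (fun x => g (b + x)) (T '' K)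
  simp only [add_neg_cancel_left] at h1
  rw [himg, h1]
  have hpre : e ⁻¹' (T '' K) = K := by
    have : T '' K = e '' K := image_congr fun z _ => (he z).symm
    rw [this, preimage_image_eq _ e.injective]
  have hme : MeasurableEmbedding e := e.toHomeomorph.measurableEmbedding
  conv_lhs => rw [hμ]
  rw [Measure.restrict_smul, integral_smul_nnreal_measure, hme.setIntegral_map, hpre]
  rfl

theorem StarPieces.exists_integral_eq [Nontrivial X]
    (hdim : Module.finrank ℝ X = Module.finrank ℝ F + 1)
    (h : StarPieces μ O c r J A R N) {b : X} (hb : b ∈ Metric.ball c r) :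
    ∃ κ : ι → ℝ, ∀ g : X → ℝ, Continuous g → ∫ x in O, g x ∂μ =
      ∑ j ∈ J, κ j * ∫ s in Ioo (0 : ℝ) 1, ∫ y in R j,
        s ^ Module.finrank ℝ F * g (b + s • (A j y - b)) ∂ν := by
  have hX : ProperSpace X := FiniteDimensional.proper ℝ X
  have hpiece : ∀ j ∈ J, ∃ κ : ℝ,
      MeasurableSet ((fun z => b + coneMap (A j) b z) '' stdCone (R j)) ∧
      ∀ g : X → ℝ, Continuous g →
      ∫ x in (fun z => b + coneMap (A j) b z) '' stdCone (R j), g x ∂μ =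
        κ * ∫ s in Ioo (0 : ℝ) 1, ∫ y in R j,
          s ^ Module.finrank ℝ F * g (b + s • (A j y - b)) ∂ν := by
    intro j hj
    rcases (R j).eq_empty_or_nonempty with he | hne
    · refine ⟨0, ?_, fun g _ => ?_⟩ <;> simp [he, stdCone]
    have hinj := coneMap_injective h.isOpen h.star hb (h.injective j hj) (h.isOpen_piece j hj) hne
      (h.piece_subset j hj)
    have hcont : Continuous (coneMap (A j) b) := LinearMap.continuous_of_finiteDimensional _
    obtain ⟨κ, hκ⟩ := exists_integral_image_eq μ ν hdim hinj b
    refine ⟨κ, ?_, fun g hg => ?_⟩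
    · refine (isOpen_stdCone (h.isOpen_piece j hj)).measurableSet.image_of_continuousOn_injOn
        (continuous_const.add hcont).continuousOn ?_
      exact (fun _ _ _ _ hxy => hinj (add_left_cancel hxy))
    · rw [hκ, integral_stdCone ν (h.isOpen_piece j hj) (h.isBounded_piece j hj)
        (G := fun z => g (b + coneMap (A j) b z)) (hg.comp (continuous_const.add hcont))]
      simp only [coneMap_smul]
  choose! κ hm hκ using hpiece
  refine ⟨κ, fun g hg => ?_⟩
  rw [setIntegral_congr_set (h.ae_eq hb), integral_biUnion_finset J hm]
  · exact Finset.sum_congr rfl fun j hj => hκ j hj g hg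
  · intro i hi j hj hij
    refine Set.disjoint_left.2 fun x hx hx' => ?_
    obtain ⟨y, hy, s, hs, rfl⟩ := mem_cone_iff.1 hx
    obtain ⟨y', hy', s', hs', he⟩ := mem_cone_iff.1 hx'
    have := (ray_frontier_inj h.isOpen h.star hb (h.piece_subset i hi ⟨y, hy, rfl⟩)
      (h.piece_subset j hj ⟨y', hy', rfl⟩) hs.1 hs'.1 he).2
    exact Set.disjoint_left.1 (h.disjoint i hi j hj hij) ⟨y, hy, rfl⟩ ⟨y', hy', this.symm⟩
  · intro j hj
    refine (hg.integrableOn_of_isBounded h.isBounded).mono_set fun x hx => ?_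
    obtain ⟨y, hy, s, hs, rfl⟩ := mem_cone_iff.1 hx
    exact cone_mem_of_starConvex h.star hb
      (frontier_subset_closure (h.piece_subset j hj ⟨y, hy, rfl⟩)) hs.1.le hs.2

/-- The integrand is the divergence of `φ(x) (x - b)`. With `m = finrank F`, multiplying it by `s ^
m` along the ray `b + s • (A y - b)` gives the exact `s`-derivative of `s ^ (m + 1) * φ`, so the
radial integral leaves only the value at `s = 1`. -/
theorem StarPieces.exists_integral_radial [Nontrivial X]
    (hdim : Module.finrank ℝ X = Module.finrank ℝ F + 1)
    (h : StarPieces μ O c r J A R N) {b : X} (hb : b ∈ Metric.ball c r) :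
    ∃ κ : ι → ℝ, ∀ φ : X → ℝ, ContDiff ℝ 1 φ →
      ∫ x in O, ((Module.finrank ℝ F + 1) * φ x + fderiv ℝ φ x (x - b)) ∂μ =
      ∑ j ∈ J, κ j * ∫ y in R j, φ (A j y) ∂ν := by
  obtain ⟨κ, hκ⟩ := h.exists_integral_eq ν hdim hb
  refine ⟨κ, fun φ hφ => ?_⟩
  set m := Module.finrank ℝ F
  have hF : ProperSpace F := FiniteDimensional.proper ℝ F
  have hcd : Continuous (fderiv ℝ φ) := hφ.continuous_fderiv one_ne_zero
  have hg : Continuous fun x => ((m : ℝ) + 1) * φ x + fderiv ℝ φ x (x - b) :=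
    (continuous_const.mul hφ.continuous).add (hcd.clm_apply (by fun_prop))
  rw [hκ _ hg]
  refine Finset.sum_congr rfl fun j hj => ?_
  congr 1
  have hAc : Continuous (A j) := (A j).continuous_of_finiteDimensional
  set G : ℝ × F → ℝ := fun z => z.1 ^ m * (((m : ℝ) + 1) * φ (b + z.1 • (A j z.2 - b)) +
    fderiv ℝ φ (b + z.1 • (A j z.2 - b)) (b + z.1 • (A j z.2 - b) - b))
  have hGc : Continuous G := by
    refine (continuous_fst.pow m).mul (hg.comp ?_)
    fun_prop
  have hGi : Integrable G ((volume.restrict (Ioo (0 : ℝ) 1)).prod (ν.restrict (R j))) := by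
    rw [Measure.prod_restrict]
    exact hGc.integrableOn_of_isBounded ((Metric.isBounded_Ioo 0 1).prod (h.isBounded_piece j hj))
  rw [integral_integral_swap (f := fun s y => G (s, y)) hGi]
  refine integral_congr_ae (Eventually.of_forall fun y => ?_)
  have hder : ∀ s ∈ uIcc (0 : ℝ) 1,
      HasDerivAt (fun s : ℝ => s ^ (m + 1) * φ (b + s • (A j y - b))) (G (s, y)) s := by
    intro s _
    have h1 : HasDerivAt (fun s : ℝ => b + s • (A j y - b)) (A j y - b) s := by
      simpa using ((hasDerivAt_id s).smul_const (A j y - b)).const_add b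
    have h2 := ((hφ.differentiable one_ne_zero _).hasFDerivAt.comp_hasDerivAt s h1)
    refine ((hasDerivAt_pow (m + 1) s).mul h2).congr_deriv ?_
    simp only [G, add_sub_cancel_left, map_smul, smul_eq_mul, Nat.add_sub_cancel, Nat.cast_add,
      Nat.cast_one, Function.comp]
    ring
  have hi : IntervalIntegrable (fun s => G (s, y)) volume 0 1 :=
    (hGc.comp (by fun_prop : Continuous fun s : ℝ => (s, y))).intervalIntegrable 0 1
  have := intervalIntegral.integral_eq_sub_of_hasDerivAt hder hi
  rw [intervalIntegral.integral_of_le zero_le_one, ← integral_Ioc_eq_integral_Ioo.symm] at this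
  simpa using this

/-- The divergence theorem in a star-shaped set with piecewise flat boundary: on every flat piece,
the component of the normal and the density of the surface measure are constants. -/
theorem StarPieces.exists_integral_fderiv_eq [Nontrivial X]
    (hdim : Module.finrank ℝ X = Module.finrank ℝ F + 1)
    (h : StarPieces μ O c r J A R N) (w : X) :
    ∃ κ : ι → ℝ, ∀ φ : X → ℝ, ContDiff ℝ 1 φ →
      ∫ x in O, fderiv ℝ φ x w ∂μ = ∑ j ∈ J, κ j * ∫ y in R j, φ (A j y) ∂ν := by
  have hX : ProperSpace X := FiniteDimensional.proper ℝ X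
  -- The radial fields based at `c - ε • w` and at `c` differ by the constant field `ε • w`.
  -- Subtracting the two radial formulas and dividing by `ε` isolates the derivative along `w`.
  obtain ⟨ε, hε, hεb⟩ : ∃ ε > (0 : ℝ), c - ε • w ∈ Metric.ball c r := by
    have hc : ContinuousAt (fun ε : ℝ => c - ε • w) 0 := by fun_prop
    have := hc.eventually_mem (Metric.isOpen_ball.mem_nhds
      (show c - (0 : ℝ) • w ∈ Metric.ball c r by simpa using h.pos))
    obtain ⟨ε, h1, h2⟩ := ((this.filter_mono nhdsWithin_le_nhds).and
      (self_mem_nhdsWithin (s := Ioi (0 : ℝ)))).exists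
    exact ⟨ε, h2, h1⟩
  obtain ⟨κ₁, h₁⟩ := h.exists_integral_radial ν hdim hεb
  obtain ⟨κ₀, h₀⟩ := h.exists_integral_radial ν hdim (Metric.mem_ball_self h.pos)
  refine ⟨fun j => ε⁻¹ * (κ₁ j - κ₀ j), fun φ hφ => ?_⟩
  have hcd : Continuous (fderiv ℝ φ) := hφ.continuous_fderiv one_ne_zero
  have hg : ∀ b, Continuous fun x => ((Module.finrank ℝ F : ℝ) + 1) * φ x + fderiv ℝ φ x (x - b) :=
    fun b => (continuous_const.mul hφ.continuous).add (hcd.clm_apply (by fun_prop))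
  have := integral_sub ((hg (c - ε • w)).integrableOn_of_isBounded h.isBounded (μ := μ))
    ((hg c).integrableOn_of_isBounded h.isBounded (μ := μ))
  rw [h₁ φ hφ, h₀ φ hφ] at this
  have h2 : ∀ x, ((Module.finrank ℝ F : ℝ) + 1) * φ x + fderiv ℝ φ x (x - (c - ε • w)) -
      (((Module.finrank ℝ F : ℝ) + 1) * φ x + fderiv ℝ φ x (x - c)) = ε * fderiv ℝ φ x w := by
    intro x
    rw [show x - (c - ε • w) = (x - c) + ε • w by module, map_add, map_smul, smul_eq_mul]
    ring
  simp only [h2] at this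
  rw [integral_const_mul, ← Finset.sum_sub_distrib] at this
  rw [← inv_mul_cancel_left₀ hε.ne' (∫ x in O, fderiv ℝ φ x w ∂μ), this, Finset.mul_sum]
  refine Finset.sum_congr rfl fun j _ => by ring

end Cone

/-! ### Polynomials as smooth functions. -/

section Poly
variable {d : ℕ}

@[simp] theorem ev_add (p q : MvPolynomial (Fin d) ℝ) (x : E d) : ev (p + q) x = ev p x + ev q x :=
  map_add _ _ _
@[simp] theorem ev_sub (p q : MvPolynomial (Fin d) ℝ) (x : E d) : ev (p - q) x = ev p x - ev q x :=
  map_sub _ _ _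
@[simp] theorem ev_mul (p q : MvPolynomial (Fin d) ℝ) (x : E d) : ev (p * q) x = ev p x * ev q x :=
  map_mul _ _ _
@[simp] theorem ev_smul (a : ℝ) (p : MvPolynomial (Fin d) ℝ) (x : E d) :
    ev (a • p) x = a * ev p x :=
  MvPolynomial.smul_eval _ _ _
@[simp] theorem ev_C (a : ℝ) (x : E d) : ev (MvPolynomial.C a) x = a := MvPolynomial.eval_C _
@[simp] theorem ev_X (i : Fin d) (x : E d) : ev (MvPolynomial.X i) x = x i := MvPolynomial.eval_X _
@[simp] theorem ev_zero (x : E d) : ev (0 : MvPolynomial (Fin d) ℝ) x = 0 := map_zero _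
@[simp] theorem ev_one (x : E d) : ev (1 : MvPolynomial (Fin d) ℝ) x = 1 := map_one _

theorem contDiff_ev (p : MvPolynomial (Fin d) ℝ) : ContDiff ℝ ∞ (ev p) := by
  induction p using MvPolynomial.induction_on with
  | C a => simpa [funext (ev_C a)] using contDiff_const
  | add p q hp hq => simpa only [funext (ev_add p q)] using hp.add hq
  | mul_X p i hp =>
    have : ContDiff ℝ ∞ fun x : E d => x i := (EuclideanSpace.proj (𝕜 := ℝ) i).contDiff
    simpa only [funext (ev_mul p _), ev_X] using hp.mul this

theorem continuous_ev (p : MvPolynomial (Fin d) ℝ) : Continuous (ev p) := (contDiff_ev p).continuous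

theorem differentiable_ev (p : MvPolynomial (Fin d) ℝ) : Differentiable ℝ (ev p) :=
  (contDiff_ev p).differentiable (by simp)

theorem partialD_mul (i : Fin d) {φ ψ : E d → ℝ} {x : E d} (hφ : DifferentiableAt ℝ φ x)
    (hψ : DifferentiableAt ℝ ψ x) :
    partialD i (fun x => φ x * ψ x) x = partialD i φ x * ψ x + φ x * partialD i ψ x := by
  simp only [partialD, fderiv_fun_mul hφ hψ]
  simp
  ring

theorem partialD_ev (i : Fin d) (p : MvPolynomial (Fin d) ℝ) (x : E d) :
    partialD i (ev p) x = ev (MvPolynomial.pderiv i p) x := by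
  induction p using MvPolynomial.induction_on with
  | C a => simp [partialD, funext (ev_C a)]
  | add p q hp hq =>
    rw [map_add, ev_add, ← hp, ← hq, funext (ev_add p q)]
    simp only [partialD]
    rw [fderiv_fun_add (differentiable_ev p x) (differentiable_ev q x)]
    rfl
  | mul_X p j hp =>
    rw [funext (ev_mul p _), partialD_mul i (differentiable_ev _ _) (differentiable_ev _ _), hp,
      Derivation.leibniz, MvPolynomial.pderiv_X]
    have : partialD i (ev (MvPolynomial.X j)) x = ev (Pi.single (M := fun _ => MvPolynomial (Fin d) ℝ) i 1 j) x := by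
      rw [funext (ev_X j)]
      have h : fderiv ℝ (fun x : E d => x j) x = EuclideanSpace.proj (𝕜 := ℝ) j :=
        (EuclideanSpace.proj (𝕜 := ℝ) j).fderiv
      rw [partialD, h]
      by_cases hij : j = i
      · subst hij; simp
      · simp [hij]
    rw [this]
    simp only [smul_eq_mul, ev_add, ev_mul]
    ring

end Poly

/-! ### Green's formula for `H¹` functions with a trace. -/

section Trace

theorem tendsto_integral_mul {α : Type*} [MeasurableSpace α] {μ : Measure α} {φ : ℕ → α → ℝ}
    {v b : α → ℝ} (hφ : ∀ n, MemLp (φ n) 2 μ) (hv : MemLp v 2 μ) (hb : MemLp b 2 μ)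
    (h : Tendsto (fun n => eLpNorm (fun x => φ n x - v x) 2 μ) atTop (𝓝 0)) :
    Tendsto (fun n => ∫ x, φ n x * b x ∂μ) atTop (𝓝 (∫ x, v x * b x ∂μ)) := by
  have h1 : Tendsto (fun n => eLpNorm (fun x => φ n x - v x) 2 μ * eLpNorm b 2 μ) atTop (𝓝 0) := by
    simpa using ENNReal.Tendsto.mul_const h (Or.inr hb.eLpNorm_ne_top)
  refine tendsto_integral_of_L1' (fun x => v x * b x) (hv.integrable_mul hb).1
    (Eventually.of_forall fun n => (hφ n).integrable_mul hb) ?_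
  refine tendsto_of_tendsto_of_tendsto_of_le_of_le tendsto_const_nhds h1 (fun _ => zero_le) ?_
  intro n
  have h2 : eLpNorm ((fun x => φ n x - v x) • b) 1 μ ≤
      eLpNorm (fun x => φ n x - v x) 2 μ * eLpNorm b 2 μ :=
    eLpNorm_smul_le_mul_eLpNorm hb.1 ((hφ n).sub hv).1
  have h3 : (fun x => φ n x * b x) - (fun x => v x * b x) = (fun x => φ n x - v x) • b := by
    ext x
    exact (sub_mul _ _ _).symm
  rw [← h3] at h2
  exact h2

variable {d : ℕ} {O : Set (E d)}

theorem memLp_of_continuous {X : Type*} [MetricSpace X] [ProperSpace X] [MeasurableSpace X]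
    [BorelSpace X] {μ : Measure X} [IsFiniteMeasure μ] {K : Set X} (hK : Bornology.IsBounded K)
    (hμ : ∀ᵐ x ∂μ, x ∈ K) {φ : X → ℝ} (hφ : Continuous φ) (p : ℝ≥0∞) : MemLp φ p μ := by
  obtain ⟨C, hC⟩ := hK.isCompact_closure.exists_bound_of_continuousOn hφ.continuousOn
  exact MemLp.of_bound hφ.aestronglyMeasurable C (hμ.mono fun x hx => hC x (subset_closure hx))

/-- For smooth approximations `φ n` this is `hdiv` applied to `φ n * q`. All terms are `L²` pairings
with a fixed bounded function, so they pass to the limit. The constants `κ j` carry the `i`-th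
component of the normal on the pieces. -/
theorem HasTrace.green (hO : IsOpen O) (hb : Bornology.IsBounded O) {ι : Type*} {J : Finset ι}
    {σ : ι → Measure (E d)} [∀ j, IsFiniteMeasure (σ j)] {K : Set (E d)}
    (hK : Bornology.IsBounded K) (hσ : ∀ j ∈ J, ∀ᵐ x ∂(σ j), x ∈ K) {i : Fin d} {κ : ι → ℝ}
    (hdiv : ∀ φ : E d → ℝ, ContDiff ℝ 1 φ →
      ∫ x in O, partialD i φ x = ∑ j ∈ J, κ j * ∫ x, φ x ∂(σ j))
    {v g : E d → ℝ} (hv : MemH1 O v) (ht : HasTrace O (∑ j ∈ J, σ j) v g)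
    (q : MvPolynomial (Fin d) ℝ) :
    (∫ x in O, weakDeriv O i v x * ev q x) + ∫ x in O, v x * ev (MvPolynomial.pderiv i q) x =
      ∑ j ∈ J, κ j * ∫ x, g x * ev q x ∂(σ j) := by
  obtain ⟨hg, φ, hφ, h1, h2, h3⟩ := ht
  have hfin : IsFiniteMeasure (volume.restrict O) := ⟨by
    rw [Measure.restrict_apply_univ]; exact hb.measure_lt_top⟩
  have hae : ∀ᵐ x ∂(volume.restrict O), x ∈ O := ae_restrict_mem hO.measurableSet
  have hle : ∀ j ∈ J, σ j ≤ ∑ j ∈ J, σ j := fun j hj => by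
    intro s
    rw [Measure.coe_finsetSum, Finset.sum_apply]
    exact Finset.single_le_sum (f := fun j => σ j s) (fun _ _ => zero_le) hj
  have hφd : ∀ n, Continuous (partialD i (φ n)) := fun n =>
    ((hφ n).continuous_fderiv (by simp)).clm_apply continuous_const
  have ht1 := tendsto_integral_mul (fun n => memLp_of_continuous hb hae (hφd n) 2) (hv.2 i).2
    (memLp_of_continuous hb hae (continuous_ev q) 2) (h2 i)
  have ht2 := tendsto_integral_mul (fun n => memLp_of_continuous hb hae (hφ n).continuous 2) hv.1
    (memLp_of_continuous hb hae (continuous_ev (MvPolynomial.pderiv i q)) 2) h1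
  have ht3 : Tendsto (fun n => ∑ j ∈ J, κ j * ∫ x, φ n x * ev q x ∂(σ j)) atTop
      (𝓝 (∑ j ∈ J, κ j * ∫ x, g x * ev q x ∂(σ j))) := by
    refine tendsto_finsetSum _ fun j hj => Tendsto.const_mul _ ?_
    refine tendsto_integral_mul (fun n => memLp_of_continuous hK (hσ j hj) (hφ n).continuous 2)
      (hg.mono_measure (hle j hj)) (memLp_of_continuous hK (hσ j hj) (continuous_ev q) 2) ?_
    exact tendsto_of_tendsto_of_tendsto_of_le_of_le tendsto_const_nhds h3 (fun _ => zero_le)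
      (fun n => eLpNorm_mono_measure _ (hle j hj))
  refine tendsto_nhds_unique (ht1.add ht2) (ht3.congr fun n => ?_)
  rw [← hdiv (fun x => φ n x * ev q x)
    (((hφ n).of_le (by simp)).mul ((contDiff_ev q).of_le (by simp))), ← integral_add]
  · refine integral_congr_ae (Eventually.of_forall fun x => ?_)
    simp only []
    rw [partialD_mul i ((hφ n).differentiable (by simp) x) (differentiable_ev q x), partialD_ev]
  · exact ((hφd n).mul (continuous_ev q)).integrableOn_of_isBounded hb
  · exact ((hφ n).continuous.mul (continuous_ev _)).integrableOn_of_isBounded hb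

end Trace

/-! ### Orthonormal frames and local coordinates of face planes. -/

section Frame

theorem linearIsometry_apply_eq (A : E 2 →ᵃⁱ[ℝ] E 3) (y : E 2) :
    A.linearIsometry y = y 0 • planeFrame A 1 + y 1 • planeFrame A 2 := by
  have : y = y 0 • EuclideanSpace.single 0 (1 : ℝ) + y 1 • EuclideanSpace.single 1 (1 : ℝ) := by
    ext i; fin_cases i <;> simp
  conv_lhs => rw [this]
  rw [map_add, map_smul, map_smul]
  rfl

theorem inner_planeFrame (A : E 2 →ᵃⁱ[ℝ] E 3) :
    inner ℝ (planeFrame A 1) (planeFrame A 1) = (1 : ℝ) ∧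
    inner ℝ (planeFrame A 1) (planeFrame A 2) = (0 : ℝ) ∧
    inner ℝ (planeFrame A 2) (planeFrame A 2) = (1 : ℝ) := by
  refine ⟨?_, ?_, ?_⟩ <;>
  · simp only [planeFrame, Matrix.cons_val_one, Matrix.cons_val_zero, Matrix.cons_val,
      LinearIsometry.inner_map_map]
    simp [EuclideanSpace.inner_single_left]

theorem orthonormal_planeFrame (A : E 2 →ᵃⁱ[ℝ] E 3) : Orthonormal ℝ (planeFrame A) := by
  obtain ⟨h11, h12, h22⟩ := inner_planeFrame A
  have h0 : (planeFrame A 0).ofLp = crossProduct (planeFrame A 1).ofLp (planeFrame A 2).ofLp := rfl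
  have e0 := congrFun h0 0
  have e1 := congrFun h0 1
  have e2 := congrFun h0 2
  simp only [cross_apply, Matrix.cons_val_zero, Matrix.cons_val_one, Matrix.cons_val] at e0 e1 e2
  rw [orthonormal_iff_ite]
  simp only [EuclideanSpace.inner_eq_star_dotProduct, star_trivial, dotProduct,
    Fin.sum_univ_three] at *
  intro i j
  fin_cases i <;> fin_cases j <;> simp only [Fin.isValue, Fin.zero_eta, Fin.mk_one, Fin.reduceFinMk,
    e0, e1, e2, if_true, Fin.reduceEq, if_false]
  · set a := (planeFrame A 1).ofLp
    set b := (planeFrame A 2).ofLp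
    -- Lagrange's identity `|a ∧ b|² = |a|² |b|² - (a · b)²`.
    linear_combination (b 0 * b 0 + b 1 * b 1 + b 2 * b 2) * h11 + h22 -
      (a 0 * b 0 + a 1 * b 1 + a 2 * b 2) * h12
  all_goals linarith

theorem eq_sum_planeFrame (A : E 2 →ᵃⁱ[ℝ] E 3) (v : E 3) (i : Fin 3) :
    v i = ∑ c, inner ℝ v (planeFrame A c) * planeFrame A c i := by
  have hc : Fintype.card (Fin 3) = Module.finrank ℝ (E 3) := by simp
  let b := (basisOfOrthonormalOfCardEqFinrank (orthonormal_planeFrame A) hc).toOrthonormalBasis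
    (by simpa using orthonormal_planeFrame A)
  have hb : ∀ c, b c = planeFrame A c := fun c => by simp [b]
  have := congrArg (fun w : E 3 => w i) (b.sum_repr' v)
  simp only [hb] at this
  rw [← this]
  simp [real_inner_comm]

theorem planeCoord_apply (A : E 2 →ᵃⁱ[ℝ] E 3) (y : E 2) : planeCoord A (A y) = y := by
  obtain ⟨h11, h12, h22⟩ := inner_planeFrame A
  have h21 : inner ℝ (planeFrame A 2) (planeFrame A 1) = (0 : ℝ) := by rw [real_inner_comm, h12]
  have : A y - A 0 = A.linearIsometry y := by
    have := A.map_vsub y 0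
    simpa using this.symm
  rw [planeCoord, this, linearIsometry_apply_eq]
  ext i
  fin_cases i <;> simp only [inner_add_right, inner_smul_right, h11, h12, h21, h22] <;> simp

theorem apply_planeCoord (A : E 2 →ᵃⁱ[ℝ] E 3) {z : E 3} (hz : z ∈ range A) :
    A (planeCoord A z) = z := by
  obtain ⟨y, rfl⟩ := hz
  rw [planeCoord_apply]

end Frame

/-! ### Faces and the element as star-shaped sets with flat boundary pieces. -/

theorem volume_affineSpan_eq_zero {d n : ℕ} (p : Fin (n + 1) → E d) (h : n < d) :
    volume (affineSpan ℝ (range p) : Set (E d)) = 0 := by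
  refine Measure.addHaar_affineSubspace _ _ fun htop => ?_
  have h1 := finrank_vectorSpan_range_le ℝ p (n := n) (by simp)
  rw [← direction_affineSpan, htop, AffineSubspace.direction_top, finrank_top] at h1
  simp at h1
  omega

theorem IsOpen.diam_pos {d : ℕ} {O : Set (E (d + 1))} (hO : IsOpen O) (hne : O.Nonempty)
    (hb : Bornology.IsBounded O) : 0 < Metric.diam O := by
  obtain ⟨x, hx⟩ := hne
  exact Metric.diam_pos (infinite_of_mem_nhds x (hO.mem_nhds hx)).nontrivial hb

namespace Polyhedron

variable (P : Polyhedron)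

theorem diam_pos : 0 < P.diam :=
  IsOpen.diam_pos P.isOpen P.isConnected.nonempty P.isBounded

/-- The source of an edge in the coordinates of a face. -/
abbrev srcCoord (f : Fin P.nF) (e : Fin P.nE) : E 2 := planeCoord (P.chart f) (P.pt (P.src e))

/-- The target of an edge in the coordinates of a face. -/
abbrev tgtCoord (f : Fin P.nF) (e : Fin P.nE) : E 2 := planeCoord (P.chart f) (P.pt (P.tgt e))

variable {P}

theorem edge_subset_range {f : Fin P.nF} {e : Fin P.nE} (he : e ∈ P.bdry f) :
    segment ℝ (P.pt (P.src e)) (P.pt (P.tgt e)) ⊆ range (P.chart f) := by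
  refine Subset.trans ?_ (image_subset_range _ (frontier (P.region f)))
  rw [P.frontier_region f]
  exact subset_biUnion_of_mem (u := fun e => segment ℝ (P.pt (P.src e)) (P.pt (P.tgt e))) he

theorem chart_srcCoord {f : Fin P.nF} {e : Fin P.nE} (he : e ∈ P.bdry f) :
    P.chart f (P.srcCoord f e) = P.pt (P.src e) :=
  apply_planeCoord _ (edge_subset_range he (left_mem_segment _ _ _))

theorem chart_tgtCoord {f : Fin P.nF} {e : Fin P.nE} (he : e ∈ P.bdry f) :
    P.chart f (P.tgtCoord f e) = P.pt (P.tgt e) :=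
  apply_planeCoord _ (edge_subset_range he (right_mem_segment _ _ _))

theorem chart_lineMap {f : Fin P.nF} {e : Fin P.nE} (he : e ∈ P.bdry f) (t : ℝ) :
    P.chart f (AffineMap.lineMap (P.srcCoord f e) (P.tgtCoord f e) t) = P.edgePt e t := by
  have := (P.chart f).toAffineMap.apply_lineMap (P.srcCoord f e) (P.tgtCoord f e) t
  simp only [AffineIsometry.coe_toAffineMap, chart_srcCoord he, chart_tgtCoord he] at this
  exact this

theorem planeCoord_edgePt {f : Fin P.nF} {e : Fin P.nE} (he : e ∈ P.bdry f) (t : ℝ) :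
    planeCoord (P.chart f) (P.edgePt e t) =
      AffineMap.lineMap (P.srcCoord f e) (P.tgtCoord f e) t := by
  rw [← chart_lineMap he, planeCoord_apply]

theorem srcCoord_ne_tgtCoord {f : Fin P.nF} {e : Fin P.nE} (he : e ∈ P.bdry f) :
    P.srcCoord f e ≠ P.tgtCoord f e := fun h => by
  have := congrArg (P.chart f) h
  rw [chart_srcCoord he, chart_tgtCoord he] at this
  exact P.src_ne_tgt e (P.pt_injective this)

theorem frontier_region_eq (f : Fin P.nF) :
    frontier (P.region f) =
      ⋃ e ∈ P.bdry f, AffineMap.lineMap (P.srcCoord f e) (P.tgtCoord f e) '' Icc (0 : ℝ) 1 := by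
  refine (P.chart f).injective.image_injective ?_
  rw [P.frontier_region f, image_iUnion₂]
  refine iUnion₂_congr fun e he => ?_
  rw [image_image]
  simp only [chart_lineMap he]
  exact segment_eq_image_lineMap ℝ _ _

/-- The pieces are the open edges. Cones over the remaining endpoints lie on finitely many lines
through the apex, which are null in the plane. -/
theorem starPieces_face {ρ : ℝ} (hρ : 0 < ρ) (hP : P.ShapeRegular ρ) (f : Fin P.nF) :
    ∃ c r, StarPieces volume (P.region f) c r (P.bdry f)
      (fun e => AffineMap.lineMap (P.srcCoord f e) (P.tgtCoord f e)) (fun _ => Ioo (0 : ℝ) 1)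
      (⋃ e ∈ P.bdry f, {P.srcCoord f e, P.tgtCoord f e}) := by
  obtain ⟨c, r, hr, hs⟩ := hP.face f
  refine ⟨c, r, P.region_isOpen f, P.region_isBounded f, (P.region_isConnected f).nonempty,
    (mul_pos hρ P.diam_pos).trans_le hr, hs, fun e he => ?_, fun _ _ => isOpen_Ioo,
    fun _ _ => Metric.isBounded_Ioo 0 1, ?_, fun e he => ?_, fun e he e' he' hne => ?_, fun b => ?_⟩
  · exact AffineMap.lineMap_injective ℝ (srcCoord_ne_tgtCoord he)
  · rw [frontier_region_eq]
    refine iUnion₂_subset fun e he => ?_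
    rintro _ ⟨t, ht, rfl⟩
    rcases eq_or_ne t 0 with rfl | h0
    · right
      exact mem_iUnion₂.2 ⟨e, he, by simp⟩
    rcases eq_or_ne t 1 with rfl | h1
    · right
      exact mem_iUnion₂.2 ⟨e, he, by simp⟩
    left
    exact mem_iUnion₂.2 ⟨e, he, t, ⟨lt_of_le_of_ne ht.1 h0.symm, lt_of_le_of_ne ht.2 h1⟩, rfl⟩
  · rw [frontier_region_eq]
    exact (image_mono Ioo_subset_Icc_self).trans (subset_biUnion_of_mem
      (u := fun e => AffineMap.lineMap (P.srcCoord f e) (P.tgtCoord f e) '' Icc (0 : ℝ) 1) he)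
  · refine Set.disjoint_left.2 ?_
    rintro _ ⟨t, ht, rfl⟩ ⟨t', ht', h⟩
    have h1 : P.edgePt e' t' = P.edgePt e t := by
      rw [← chart_lineMap he, ← chart_lineMap he', h]
    have hmem : ∀ (e : Fin P.nE) (t : ℝ), t ∈ Ioo (0 : ℝ) 1 →
        P.edgePt e t ∈ segment ℝ (P.pt (P.src e)) (P.pt (P.tgt e)) := fun e t ht => by
      rw [segment_eq_image_lineMap]
      exact ⟨t, Ioo_subset_Icc_self ht, rfl⟩
    have h2 := (P.edges_inter e e' hne ⟨hmem e t ht, h1 ▸ hmem e' t' ht'⟩).1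
    have hinj : Function.Injective (P.edgePt e) :=
      AffineMap.lineMap_injective ℝ fun h => P.src_ne_tgt e (P.pt_injective h)
    rcases h2 with h2 | h2
    · have : t = 0 := hinj (h2.trans (by simp [edgePt]))
      exact ht.1.ne' this
    · have : t = 1 := hinj (Eq.trans (Set.mem_singleton_iff.1 h2) (by simp [edgePt]))
      exact ht.2.ne this
  · have hnull : ∀ y : E 2, volume (affineSpan ℝ (range ![b, y]) : Set (E 2)) = 0 := fun y =>
      volume_affineSpan_eq_zero _ (by norm_num)
    have hsub : ∀ (y : E 2) (s : ℝ), b + s • (y - b) ∈ affineSpan ℝ (range ![b, y]) := fun y s => by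
      have := AffineMap.lineMap_mem s (subset_affineSpan ℝ (range ![b, y]) ⟨0, rfl⟩)
        (subset_affineSpan ℝ (range ![b, y]) ⟨1, rfl⟩)
      rw [AffineMap.lineMap_apply] at this
      simpa [add_comm] using this
    refine measure_mono_null (t := ⋃ e ∈ P.bdry f,
      ((affineSpan ℝ (range ![b, P.srcCoord f e]) : Set (E 2)) ∪
        (affineSpan ℝ (range ![b, P.tgtCoord f e]) : Set (E 2)))) ?_
      ((measure_biUnion_null_iff (P.bdry f).countable_toSet).2 fun e _ =>
        measure_union_null (hnull _) (hnull _))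
    rintro _ ⟨y, hy, s, rfl⟩
    obtain ⟨e, he, hy⟩ := mem_iUnion₂.1 hy
    refine mem_iUnion₂.2 ⟨e, he, ?_⟩
    rcases hy with rfl | hy
    · exact Or.inl (hsub _ _)
    · rw [Set.mem_singleton_iff.1 hy]
      exact Or.inr (hsub _ _)

/-- The pieces are the relatively open faces. Cones over the edges lie in the affine spans of the
apex and two vertices, which are null in space. -/
theorem starPieces_element {ρ : ℝ} (hρ : 0 < ρ) (hP : P.ShapeRegular ρ) :
    ∃ c r, StarPieces volume P.carrier c r Finset.univ
      (fun f => (P.chart f).toAffineMap) P.region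
      (⋃ e, segment ℝ (P.pt (P.src e)) (P.pt (P.tgt e))) := by
  obtain ⟨c, r, hr, hs⟩ := hP.element
  have hpiece : ∀ f, P.chart f '' closure (P.region f) ⊆ frontier P.carrier := fun f => by
    rw [P.frontier_carrier]
    exact subset_iUnion (fun f => P.chart f '' closure (P.region f)) f
  refine ⟨c, r, P.isOpen, P.isBounded, P.isConnected.nonempty,
    (mul_pos hρ P.diam_pos).trans_le hr, hs, fun f _ => (P.chart f).injective,
    fun f _ => P.region_isOpen f, fun f _ => P.region_isBounded f, ?_, fun f _ => ?_,
    fun f _ g _ hne => ?_, fun b => ?_⟩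
  · rw [P.frontier_carrier]
    refine iUnion_subset fun f => ?_
    rw [closure_eq_self_union_frontier, image_union, P.frontier_region f]
    refine union_subset_union ?_ ?_
    · exact subset_iUnion₂ (s := fun f (_ : f ∈ Finset.univ) => P.chart f '' P.region f) f
        (Finset.mem_univ f)
    · exact iUnion₂_subset fun e _ => subset_iUnion
        (fun e => segment ℝ (P.pt (P.src e)) (P.pt (P.tgt e))) e
  · exact (image_mono subset_closure).trans (hpiece f)
  · exact (P.faces_disjoint f g hne).mono_right (image_mono subset_closure)
  · refine measure_mono_null (t := ⋃ e,
      (affineSpan ℝ (range ![b, P.pt (P.src e), P.pt (P.tgt e)]) : Set (E 3))) ?_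
      (measure_iUnion_null fun e => volume_affineSpan_eq_zero _ (by norm_num))
    rintro _ ⟨y, hy, s, rfl⟩
    obtain ⟨e, hy⟩ := mem_iUnion.1 hy
    refine mem_iUnion.2 ⟨e, ?_⟩
    rw [segment_eq_image_lineMap] at hy
    obtain ⟨t, -, rfl⟩ := hy
    have hm := fun i => subset_affineSpan ℝ (range ![b, P.pt (P.src e), P.pt (P.tgt e)]) ⟨i, rfl⟩
    have := AffineMap.lineMap_mem s (hm 0) (AffineMap.lineMap_mem t (hm 1) (hm 2))
    rw [AffineMap.lineMap_apply] at this
    simpa [add_comm] using this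

end Polyhedron

/-! ### Boundary measures and Green's formula on faces and in the element. -/

section SegMeasure

variable {d : ℕ}

instance isFiniteMeasure_segMeasure (a b : E d) : IsFiniteMeasure (segMeasure a b) :=
  Measure.smul_finite _ ENNReal.ofReal_ne_top

theorem measurableEmbedding_lineMap {a b : E d} (h : a ≠ b) :
    MeasurableEmbedding (fun t : ℝ => AffineMap.lineMap a b t) :=
  Continuous.measurableEmbedding AffineMap.lineMap_continuous (AffineMap.lineMap_injective ℝ h)

theorem integral_segMeasure {a b : E d} (h : a ≠ b) (g : E d → ℝ) :
    ∫ x, g x ∂(segMeasure a b) = ‖b - a‖ * ∫ t in Icc (0 : ℝ) 1, g (AffineMap.lineMap a b t) := by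
  rw [segMeasure, integral_smul_measure, (measurableEmbedding_lineMap h).integral_map,
    ENNReal.toReal_ofReal (norm_nonneg _), smul_eq_mul]

theorem ae_segMeasure_mem (a b : E d) :
    ∀ᵐ x ∂(segMeasure a b), x ∈ (fun t : ℝ => AffineMap.lineMap a b t) '' Icc 0 1 := by
  have hc : Continuous fun t : ℝ => AffineMap.lineMap a b t := AffineMap.lineMap_continuous
  have hm : MeasurableSet ((fun t : ℝ => AffineMap.lineMap a b t) '' Icc 0 1) :=
    (isCompact_Icc.image hc).isClosed.measurableSet
  refine Measure.ae_smul_measure ?_ _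
  refine (ae_map_iff (p := fun x => x ∈ (fun t : ℝ => AffineMap.lineMap a b t) '' Icc 0 1)
    hc.aemeasurable hm).2 ?_
  exact (ae_restrict_mem measurableSet_Icc).mono fun t ht => ⟨t, ht, rfl⟩

end SegMeasure

namespace Polyhedron

variable {P : Polyhedron}

theorem measurableEmbedding_chart (f : Fin P.nF) : MeasurableEmbedding (P.chart f) :=
  Continuous.measurableEmbedding (P.chart f).continuous (P.chart f).injective

instance isFiniteMeasure_restrict_region (f : Fin P.nF) :
    IsFiniteMeasure (volume.restrict (P.region f)) :=
  ⟨by rw [Measure.restrict_apply_univ]; exact (P.region_isBounded f).measure_lt_top⟩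

instance isFiniteMeasure_restrict_carrier : IsFiniteMeasure (volume.restrict P.carrier) :=
  ⟨by rw [Measure.restrict_apply_univ]; exact P.isBounded.measure_lt_top⟩

instance isFiniteMeasure_faceBdry (f : Fin P.nF) : IsFiniteMeasure (P.faceBdry f) := by
  unfold faceBdry
  infer_instance

instance isFiniteMeasure_surf : IsFiniteMeasure P.surf := by
  unfold surf
  infer_instance

theorem ae_mem_region (f : Fin P.nF) : ∀ᵐ y ∂(volume.restrict (P.region f)), y ∈ P.region f :=
  ae_restrict_mem (P.region_isOpen f).measurableSet

theorem isBounded_frontier_region (f : Fin P.nF) :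
    Bornology.IsBounded (frontier (P.region f)) :=
  (P.region_isBounded f).closure.subset frontier_subset_closure

theorem isBounded_frontier_carrier : Bornology.IsBounded (frontier P.carrier) :=
  P.isBounded.closure.subset frontier_subset_closure

theorem ae_segMeasure_mem_frontier {f : Fin P.nF} {e : Fin P.nE} (he : e ∈ P.bdry f) :
    ∀ᵐ x ∂(segMeasure (P.srcCoord f e) (P.tgtCoord f e)), x ∈ frontier (P.region f) := by
  refine (ae_segMeasure_mem _ _).mono fun x hx => ?_
  rw [frontier_region_eq]
  exact mem_iUnion₂.2 ⟨e, he, hx⟩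

theorem ae_map_chart_mem_frontier (f : Fin P.nF) :
    ∀ᵐ x ∂((volume.restrict (P.region f)).map (P.chart f)), x ∈ frontier P.carrier := by
  refine (ae_map_iff (p := fun x => x ∈ frontier P.carrier) (P.chart f).continuous.aemeasurable
    (by simpa using isClosed_frontier.measurableSet)).2 ?_
  refine (ae_mem_region f).mono fun y hy => ?_
  rw [P.frontier_carrier]
  exact mem_iUnion.2 ⟨f, y, subset_closure hy, rfl⟩

theorem ae_faceBdry_mem (f : Fin P.nF) :
    ∀ᵐ x ∂(P.faceBdry f), x ∈ frontier (P.region f) := by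
  rw [ae_iff, faceBdry, Measure.finsetSum_apply]
  exact Finset.sum_eq_zero fun e he => ae_segMeasure_mem_frontier he

theorem ae_surf_mem : ∀ᵐ x ∂P.surf, x ∈ frontier P.carrier := by
  rw [ae_iff, surf, Measure.finsetSum_apply]
  exact Finset.sum_eq_zero fun f _ => ae_map_chart_mem_frontier f

theorem integral_faceBdry (f : Fin P.nF) {g : E 2 → ℝ} (hg : Integrable g (P.faceBdry f)) :
    ∫ x, g x ∂(P.faceBdry f) = ∑ e ∈ P.bdry f, ‖P.tgtCoord f e - P.srcCoord f e‖ *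
      ∫ t in Icc (0 : ℝ) 1, g (planeCoord (P.chart f) (P.edgePt e t)) := by
  have hle : ∀ e ∈ P.bdry f, segMeasure (P.srcCoord f e) (P.tgtCoord f e) ≤ P.faceBdry f := by
    intro e he s
    rw [faceBdry, Measure.coe_finsetSum, Finset.sum_apply]
    exact Finset.single_le_sum (f := fun e => segMeasure (P.srcCoord f e) (P.tgtCoord f e) s)
      (fun _ _ => zero_le) he
  rw [faceBdry, integral_finsetSum_measure fun e he => hg.mono_measure (hle e he)]
  refine Finset.sum_congr rfl fun e he => ?_
  rw [integral_segMeasure (srcCoord_ne_tgtCoord he)]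
  simp only [planeCoord_edgePt he]

theorem integral_surf {g : E 3 → ℝ} (hg : Integrable g P.surf) :
    ∫ x, g x ∂P.surf = ∑ f, ∫ y in P.region f, g (P.chart f y) := by
  have hle : ∀ f ∈ Finset.univ, (volume.restrict (P.region f)).map (P.chart f) ≤ P.surf := by
    intro f hf s
    rw [surf, Measure.coe_finsetSum, Finset.sum_apply]
    exact Finset.single_le_sum (f := fun f => (volume.restrict (P.region f)).map (P.chart f) s)
      (fun _ _ => zero_le) hf
  rw [surf, integral_finsetSum_measure fun f hf => hg.mono_measure (hle f hf)]
  exact Finset.sum_congr rfl fun f _ => (measurableEmbedding_chart f).integral_map _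

/-- Green's formula in a face. -/
theorem face_green {ρ : ℝ} (hρ : 0 < ρ) (hP : P.ShapeRegular ρ) (f : Fin P.nF) (i : Fin 2) :
    ∃ κ : Fin P.nE → ℝ, ∀ w, MemH1 (P.region f) w → HasTrace (P.region f) (P.faceBdry f) w w →
      ∀ q : MvPolynomial (Fin 2) ℝ,
      (∫ y in P.region f, weakDeriv (P.region f) i w y * ev q y) +
        ∫ y in P.region f, w y * ev (MvPolynomial.pderiv i q) y =
      ∑ e ∈ P.bdry f, κ e * ∫ t in Icc (0 : ℝ) 1,
        w (planeCoord (P.chart f) (P.edgePt e t)) *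
          ev q (planeCoord (P.chart f) (P.edgePt e t)) := by
  obtain ⟨c, r, h⟩ := starPieces_face hρ hP f
  obtain ⟨κ, hκ⟩ := h.exists_integral_fderiv_eq volume (by simp) (EuclideanSpace.single i 1)
  refine ⟨κ, fun w hw ht q => ?_⟩
  -- `segMeasure` carries the edge length as density, whereas `κ` refers to the parameter interval;
  -- the quotient converts one into the other.
  set κ' : Fin P.nE → ℝ := fun e => κ e / ‖P.tgtCoord f e - P.srcCoord f e‖
  have hpos : ∀ e ∈ P.bdry f, ‖P.tgtCoord f e - P.srcCoord f e‖ ≠ 0 := fun e he =>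
    norm_ne_zero_iff.2 (sub_ne_zero.2 (srcCoord_ne_tgtCoord he).symm)
  have key : ∀ (g : E 2 → ℝ), ∀ e ∈ P.bdry f,
      κ' e * ∫ x, g x ∂(segMeasure (P.srcCoord f e) (P.tgtCoord f e)) =
        κ e * ∫ t in Icc (0 : ℝ) 1, g (AffineMap.lineMap (P.srcCoord f e) (P.tgtCoord f e) t) := by
    intro g e he
    rw [integral_segMeasure (srcCoord_ne_tgtCoord he), ← mul_assoc, div_mul_cancel₀ _ (hpos e he)]
  have := HasTrace.green (P.region_isOpen f) (P.region_isBounded f)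
    (σ := fun e => segMeasure (P.srcCoord f e) (P.tgtCoord f e)) (isBounded_frontier_region f)
    (fun e he => ae_segMeasure_mem_frontier he) (i := i) (κ := κ') (fun φ hφ => ?_) hw ht q
  · rw [this]
    refine Finset.sum_congr rfl fun e he => ?_
    rw [key _ e he]
    simp only [planeCoord_edgePt he]
  · refine (hκ φ hφ).trans (Finset.sum_congr rfl fun e he => ?_)
    rw [key _ e he, integral_Icc_eq_integral_Ioo]

/-- Green's formula in the element. -/
theorem element_green {ρ : ℝ} (hρ : 0 < ρ) (hP : P.ShapeRegular ρ) (i : Fin 3) :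
    ∃ κ : Fin P.nF → ℝ, ∀ v, MemH1 P.carrier v → HasTrace P.carrier P.surf v v →
      ∀ q : MvPolynomial (Fin 3) ℝ,
      (∫ x in P.carrier, weakDeriv P.carrier i v x * ev q x) +
        ∫ x in P.carrier, v x * ev (MvPolynomial.pderiv i q) x =
      ∑ f, κ f * ∫ y in P.region f, v (P.chart f y) * ev q (P.chart f y) := by
  obtain ⟨c, r, h⟩ := starPieces_element hρ hP
  obtain ⟨κ, hκ⟩ := h.exists_integral_fderiv_eq volume (by simp) (EuclideanSpace.single i 1)
  refine ⟨κ, fun v hv ht q => ?_⟩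
  have key : ∀ (g : E 3 → ℝ) (f : Fin P.nF),
      ∫ x, g x ∂((volume.restrict (P.region f)).map (P.chart f)) =
        ∫ y in P.region f, g (P.chart f y) :=
    fun g f => (measurableEmbedding_chart f).integral_map _
  have := HasTrace.green P.isOpen P.isBounded
    (σ := fun f => (volume.restrict (P.region f)).map (P.chart f)) isBounded_frontier_carrier
    (fun f _ => ae_map_chart_mem_frontier f) (i := i) (κ := κ) (fun φ hφ => ?_) hv ht q
  · rw [this]
    simp only [key]
  · simp only [key]
    exact hκ φ hφ

/-- A nonempty bounded open set has nonempty frontier, so the face has an edge, of positive length.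
This makes the boundary mean detect constants in the `H¹`-seminorm projection. -/
theorem faceBdry_ne_zero (f : Fin P.nF) : (P.faceBdry f).real univ ≠ 0 := by
  have hne : (frontier (P.region f)).Nonempty := by
    refine nonempty_frontier_iff.2 ⟨(P.region_isConnected f).nonempty, fun h => ?_⟩
    exact NormedSpace.unbounded_univ ℝ (E 2) (h ▸ P.region_isBounded f)
  rw [frontier_region_eq] at hne
  obtain ⟨x, hx⟩ := hne
  obtain ⟨e, he, -⟩ := mem_iUnion₂.1 hx
  have h1 := integral_faceBdry f (integrable_const (1 : ℝ))
  simp only [integral_const, smul_eq_mul, mul_one] at h1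
  rw [h1]
  simp only [measureReal_restrict_apply_univ, Real.volume_real_Icc, sub_zero, zero_le_one,
    sup_of_le_left, mul_one]
  refine (Finset.sum_pos' (fun _ _ => norm_nonneg _) ⟨e, he, ?_⟩).ne'
  exact norm_pos_iff.2 (sub_ne_zero.2 (srcCoord_ne_tgtCoord he).symm)

theorem surf_ne_zero : P.surf.real univ ≠ 0 := by
  have hne : (frontier P.carrier).Nonempty := by
    refine nonempty_frontier_iff.2 ⟨P.isConnected.nonempty, fun h => ?_⟩
    exact NormedSpace.unbounded_univ ℝ (E 3) (h ▸ P.isBounded)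
  rw [P.frontier_carrier] at hne
  obtain ⟨x, hx⟩ := hne
  obtain ⟨f, -⟩ := mem_iUnion.1 hx
  have h1 := integral_surf (P := P) (integrable_const (1 : ℝ))
  simp only [integral_const, smul_eq_mul, mul_one] at h1
  rw [h1]
  refine (Finset.sum_pos' (fun _ _ => measureReal_nonneg) ⟨f, Finset.mem_univ f, ?_⟩).ne'
  rw [measureReal_restrict_apply_univ]
  exact ENNReal.toReal_pos ((P.region_isOpen f).measure_pos volume
    (P.region_isConnected f).nonempty).ne' (P.region_isBounded f).measure_lt_top.ne

end Polyhedron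

/-! ### Polynomial spaces and the splitting of polynomial vector fields. -/

section Degree

open MvPolynomial

variable {d : ℕ}

theorem monomial_mem_polyLE {n : ℤ} {s : Fin d →₀ ℕ} (h : (s.degree : ℤ) ≤ n) (a : ℝ) :
    monomial s a ∈ polyLE d n :=
  (monomial_mem_restrictSupport ℝ).2 (Or.inl h)

theorem mem_polyLE_iff {n : ℤ} {p : MvPolynomial (Fin d) ℝ} :
    p ∈ polyLE d n ↔ ∀ s ∈ p.support, (s.degree : ℤ) ≤ n := Iff.rfl

theorem polyLE_mono {m n : ℤ} (h : m ≤ n) : polyLE d m ≤ polyLE d n := fun _ hp =>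
  mem_polyLE_iff.2 fun s hs => (mem_polyLE_iff.1 hp s hs).trans h

theorem polyLE_induction {n : ℤ} {C : MvPolynomial (Fin d) ℝ → Prop} (h0 : C 0)
    (hadd : ∀ p q, C p → C q → C (p + q))
    (hmon : ∀ (s : Fin d →₀ ℕ) (a : ℝ), (s.degree : ℤ) ≤ n → C (monomial s a))
    {p : MvPolynomial (Fin d) ℝ} (hp : p ∈ polyLE d n) : C p := by
  rw [← p.support_sum_monomial_coeff]
  exact Finset.sum_induction _ C hadd h0 fun s hs => hmon s _ (mem_polyLE_iff.1 hp s hs)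

theorem C_mem_polyLE {n : ℤ} (h : 0 ≤ n) (a : ℝ) : C a ∈ polyLE d n :=
  monomial_mem_polyLE (by simpa using h) a

theorem one_mem_polyLE {n : ℤ} (h : 0 ≤ n) : (1 : MvPolynomial (Fin d) ℝ) ∈ polyLE d n :=
  C_mem_polyLE h 1

theorem X_mem_polyLE (i : Fin d) : (X i : MvPolynomial (Fin d) ℝ) ∈ polyLE d 1 :=
  monomial_mem_polyLE (by simp) 1

theorem mul_mem_polyLE {m n : ℤ} {p q : MvPolynomial (Fin d) ℝ} (hp : p ∈ polyLE d m)
    (hq : q ∈ polyLE d n) : p * q ∈ polyLE d (m + n) := by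
  have h := Submodule.mul_mem_mul hp hq
  rw [polyLE, polyLE, ← restrictSupport_add] at h
  refine restrictSupport_mono ℝ ?_ h
  rintro _ ⟨s, hs, t, ht, rfl⟩
  have hs' : (s.degree : ℤ) ≤ m := hs
  have ht' : (t.degree : ℤ) ≤ n := ht
  change ((s + t).degree : ℤ) ≤ m + n
  rw [map_add]
  push_cast
  omega

theorem pow_mem_polyLE {p : MvPolynomial (Fin d) ℝ} (hp : p ∈ polyLE d 1) (m : ℕ) :
    p ^ m ∈ polyLE d m := by
  induction m with
  | zero => exact one_mem_polyLE (by simp)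
  | succ m ih =>
    rw [pow_succ]
    exact_mod_cast mul_mem_polyLE ih hp

theorem prod_mem_polyLE {ι : Type*} (J : Finset ι) {m : ι → ℕ} {p : ι → MvPolynomial (Fin d) ℝ}
    (hp : ∀ j ∈ J, p j ∈ polyLE d (m j)) : ∏ j ∈ J, p j ∈ polyLE d (∑ j ∈ J, m j : ℕ) := by
  classical
  induction J using Finset.induction_on with
  | empty => exact one_mem_polyLE (by simp)
  | insert j J hj ih =>
    rw [Finset.prod_insert hj, Finset.sum_insert hj]
    push_cast at ih ⊢
    exact mul_mem_polyLE (hp j (Finset.mem_insert_self _ _))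
      (ih fun i hi => hp i (Finset.mem_insert_of_mem hi))

theorem pderiv_mem_polyLE {n : ℤ} {p : MvPolynomial (Fin d) ℝ} (hp : p ∈ polyLE d n)
    (i : Fin d) : pderiv i p ∈ polyLE d (n - 1) := by
  refine polyLE_induction (C := fun p => pderiv i p ∈ polyLE d (n - 1)) ?_ ?_ ?_ hp
  · simp
  · intro p q hp hq
    rw [map_add]
    exact add_mem hp hq
  · intro s a hs
    rw [pderiv_monomial]
    by_cases h0 : s i = 0
    · simp [h0]
    · refine monomial_mem_polyLE ?_ _
      have h1 : s - Finsupp.single i 1 + Finsupp.single i 1 = s :=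
        tsub_add_cancel_of_le (Finsupp.single_le_iff.2 (Nat.one_le_iff_ne_zero.2 h0))
      have h2 := congrArg Finsupp.degree h1
      rw [map_add, Finsupp.degree_single] at h2
      omega

theorem pderiv_mem_polyLE_of_le {m n : ℤ} {p : MvPolynomial (Fin d) ℝ} (hp : p ∈ polyLE d n)
    (h : n - 1 ≤ m) (i : Fin d) : pderiv i p ∈ polyLE d m :=
  polyLE_mono h (pderiv_mem_polyLE hp i)

instance finiteDimensional_polyLE (n : ℤ) : FiniteDimensional ℝ (polyLE d n) := by
  have hfin : {s : Fin d →₀ ℕ | (s.degree : ℤ) ≤ n}.Finite :=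
    (Finsupp.finite_of_degree_le n.toNat).subset fun s hs => by
      have h : (s.degree : ℤ) ≤ n := hs
      change s.degree ≤ n.toNat
      omega
  have : Finite {s : Fin d →₀ ℕ | (s.degree : ℤ) ≤ n} := hfin
  exact Module.Finite.of_basis (basisRestrictSupport ℝ {s : Fin d →₀ ℕ | (s.degree : ℤ) ≤ n})

/-- Splitting a polynomial into its part of degree `≤ m` and the rest. -/
theorem exists_polyLE_add_polyHat {n : ℤ} (m : ℤ) {p : MvPolynomial (Fin d) ℝ}
    (hp : p ∈ polyLE d n) : ∃ p₁ ∈ polyLE d m, ∃ p₂ ∈ polyHat d n m, p = p₁ + p₂ := by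
  refine polyLE_induction (C := fun p => ∃ p₁ ∈ polyLE d m, ∃ p₂ ∈ polyHat d n m, p = p₁ + p₂)
    ⟨0, zero_mem _, 0, zero_mem _, by simp⟩ ?_ ?_ hp
  · rintro _ _ ⟨p₁, h₁, p₂, h₂, rfl⟩ ⟨q₁, g₁, q₂, g₂, rfl⟩
    exact ⟨_, add_mem h₁ g₁, _, add_mem h₂ g₂, by ring⟩
  · intro s a hs
    by_cases h : (s.degree : ℤ) ≤ m
    · exact ⟨_, monomial_mem_polyLE h a, 0, zero_mem _, by simp⟩
    · exact ⟨0, zero_mem _, monomial s a, (monomial_mem_restrictSupport ℝ).2 (Or.inl ⟨not_le.1 h, hs⟩), by simp⟩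

theorem eq_C_of_mem_polyLE_zero {p : MvPolynomial (Fin d) ℝ} (hp : p ∈ polyLE d 0) :
    ∃ a, p = C a := by
  refine polyLE_induction (C := fun p => ∃ a, p = C a) ⟨0, by simp⟩ ?_ ?_ hp
  · rintro _ _ ⟨a, rfl⟩ ⟨b, rfl⟩
    exact ⟨a + b, by simp⟩
  · intro s a hs
    have : s = 0 := by
      rw [← Finsupp.degree_eq_zero_iff]
      omega
    exact ⟨a, by rw [this]; rfl⟩

/-- Polynomials are stable under affine substitutions. -/
theorem exists_comp_mem_polyLE {d' : ℕ} {n : ℤ} {F : E d' → E d} {l : Fin d → MvPolynomial (Fin d') ℝ}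
    (hl : ∀ i, l i ∈ polyLE d' 1) (hF : ∀ y i, F y i = ev (l i) y) {p : MvPolynomial (Fin d) ℝ}
    (hp : p ∈ polyLE d n) : ∃ q ∈ polyLE d' n, ∀ y, ev p (F y) = ev q y := by
  refine polyLE_induction (C := fun p => ∃ q ∈ polyLE d' n, ∀ y, ev p (F y) = ev q y)
    ⟨0, zero_mem _, by simp⟩ ?_ ?_ hp
  · rintro p q ⟨p', hp', h⟩ ⟨q', hq', h'⟩
    exact ⟨_, add_mem hp' hq', fun y => by rw [ev_add, ev_add, h, h']⟩
  · intro s a hs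
    refine ⟨a • ∏ i, l i ^ s i, Submodule.smul_mem _ _ (polyLE_mono ?_
      (prod_mem_polyLE Finset.univ fun i _ => pow_mem_polyLE (hl i) (s i))), fun y => ?_⟩
    · rw [← Finsupp.degree_eq_sum]
      exact hs
    · rw [ev_smul, ev, eval_monomial, Finsupp.prod_fintype _ _ (by simp)]
      simp only [ev, map_prod, map_pow]
      congr 1
      refine Finset.prod_congr rfl fun i _ => ?_
      rw [hF]
      rfl

/-- An open set contains a box, and a polynomial vanishing on a product of infinite sets is zero. -/
theorem eq_zero_of_ev_eq_zero {O : Set (E d)} (hO : IsOpen O) (hne : O.Nonempty)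
    {p : MvPolynomial (Fin d) ℝ} (h : ∀ x ∈ O, ev p x = 0) : p = 0 := by
  obtain ⟨x, hx⟩ := hne
  have hO' : IsOpen ((WithLp.toLp 2 : (Fin d → ℝ) → E d) ⁻¹' O) :=
    hO.preimage (PiLp.continuous_toLp 2 _)
  obtain ⟨ε, hε, hb⟩ := Metric.isOpen_iff.1 hO' x.ofLp (by simpa using hx)
  rw [ball_pi _ hε] at hb
  refine funext_set (fun i => Metric.ball (x i) ε)
    (fun i => infinite_of_mem_nhds (x i) (Metric.ball_mem_nhds _ hε)) fun y hy => ?_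
  rw [map_zero]
  exact h _ (hb hy)

theorem eq_C_of_pderiv_eq_zero {p : MvPolynomial (Fin d) ℝ} (h : ∀ i, pderiv i p = 0) :
    ∃ a, p = C a := by
  refine ⟨coeff 0 p, ?_⟩
  ext s
  rw [coeff_C]
  split_ifs with hs
  · rw [hs]
  · obtain ⟨i, hi⟩ := Finsupp.ne_iff.1 (Ne.symm hs)
    have h1 : s - Finsupp.single i 1 + Finsupp.single i 1 = s :=
      tsub_add_cancel_of_le (Finsupp.single_le_iff.2 (Nat.one_le_iff_ne_zero.2 hi))
    have h2 := congrArg (coeff (s - Finsupp.single i 1)) (h i)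
    rw [coeff_pderiv, h1, coeff_zero] at h2
    have h3 : ((s - Finsupp.single i 1 : Fin d →₀ ℕ) i : ℝ) + 1 ≠ 0 := by positivity
    exact (mul_eq_zero.1 h2).resolve_right h3

/-- The polynomial vector field `x ∧ p`. -/
def wedge (p : Fin 3 → MvPolynomial (Fin 3) ℝ) : Fin 3 → MvPolynomial (Fin 3) ℝ :=
  ![X 1 * p 2 - X 2 * p 1, X 2 * p 0 - X 0 * p 2, X 0 * p 1 - X 1 * p 0]

theorem xWedge_eq (p : Fin 3 → MvPolynomial (Fin 3) ℝ) (x : E 3) (i : Fin 3) :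
    Polyhedron.xWedge p x i = ev (wedge p i) x := by
  fin_cases i <;> simp [Polyhedron.xWedge, wedge, cross_apply]

theorem wedge_add (p q : Fin 3 → MvPolynomial (Fin 3) ℝ) : wedge (p + q) = wedge p + wedge q := by
  ext1 i
  fin_cases i <;> simp [wedge] <;> ring

/-- The decomposition of homogeneous vector fields
`(m + 1) r = ∇ (x · r) - x ∧ curl r`. -/
theorem exists_grad_add_wedge_of_homogeneous {m : ℕ} {n : ℤ}
    {r : Fin 3 → MvPolynomial (Fin 3) ℝ} (hr : ∀ i, (r i).IsHomogeneous m)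
    (hrn : ∀ i, r i ∈ polyLE 3 n) :
    ∃ φ ∈ polyLE 3 (n + 1), ∃ p : Fin 3 → MvPolynomial (Fin 3) ℝ,
      (∀ i, p i ∈ polyLE 3 (n - 1)) ∧ ∀ i, r i = pderiv i φ + wedge p i := by
  set c : ℝ := ((m : ℝ) + 1)⁻¹
  have hc : c * (m + 1) = 1 := inv_mul_cancel₀ (by positivity)
  -- Expanding `∇ (x · r) - x ∧ curl r` leaves `r i + x · ∇ (r i)` in component `i`; Euler's
  -- identity turns the second term into `m * r i`.
  have heuler : ∀ i, X 0 * pderiv 0 (r i) + X 1 * pderiv 1 (r i) + X 2 * pderiv 2 (r i) =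
      C (m : ℝ) * r i := fun i => by
    have := (hr i).sum_X_mul_pderiv
    rw [Fin.sum_univ_three, nsmul_eq_mul] at this
    rw [this, map_natCast]
  have hcC : C c * (C (m : ℝ) + 1) = (1 : MvPolynomial (Fin 3) ℝ) := by
    rw [← C_1, ← C_add, ← C_mul, hc]
  refine ⟨C c * (X 0 * r 0 + X 1 * r 1 + X 2 * r 2), ?_,
    fun i => C (-c) * ![pderiv 1 (r 2) - pderiv 2 (r 1), pderiv 2 (r 0) - pderiv 0 (r 2),
      pderiv 0 (r 1) - pderiv 1 (r 0)] i, fun i => ?_, fun i => ?_⟩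
  · rw [← smul_eq_C_mul]
    refine Submodule.smul_mem _ _ (add_mem (add_mem ?_ ?_) ?_) <;>
    · rw [add_comm n 1]
      exact mul_mem_polyLE (X_mem_polyLE _) (hrn _)
  · simp only [← smul_eq_C_mul]
    refine Submodule.smul_mem _ _ ?_
    fin_cases i <;> exact sub_mem (pderiv_mem_polyLE (hrn _) _) (pderiv_mem_polyLE (hrn _) _)
  · have h01 : (1 : Fin 3) ≠ 0 := by decide
    have h02 : (2 : Fin 3) ≠ 0 := by decide
    have h12 : (2 : Fin 3) ≠ 1 := by decide
    fin_cases i <;>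
    · simp only [Fin.zero_eta, Fin.mk_one, Fin.reduceFinMk, wedge, Matrix.cons_val_zero,
        Matrix.cons_val_one, Matrix.cons_val, Derivation.leibniz, smul_eq_mul, pderiv_C, mul_zero,
        add_zero, map_add, pderiv_X_self, pderiv_X_of_ne h01, pderiv_X_of_ne h02,
        pderiv_X_of_ne h12, pderiv_X_of_ne h01.symm, pderiv_X_of_ne h02.symm,
        pderiv_X_of_ne h12.symm, mul_one, C_neg]
      first
      | linear_combination -(r 0) * hcC - C c * heuler 0
      | linear_combination -(r 1) * hcC - C c * heuler 1
      | linear_combination -(r 2) * hcC - C c * heuler 2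

/-- The property is additive, so it suffices to treat a single monomial in a single component, which
is a homogeneous field. -/
theorem exists_grad_add_wedge {n : ℤ} {r : Fin 3 → MvPolynomial (Fin 3) ℝ}
    (hr : ∀ i, r i ∈ polyLE 3 n) :
    ∃ φ ∈ polyLE 3 (n + 1), ∃ p : Fin 3 → MvPolynomial (Fin 3) ℝ,
      (∀ i, p i ∈ polyLE 3 (n - 1)) ∧ ∀ i, r i = pderiv i φ + wedge p i := by
  set Q : (Fin 3 → MvPolynomial (Fin 3) ℝ) → Prop := fun r =>
    ∃ φ ∈ polyLE 3 (n + 1), ∃ p : Fin 3 → MvPolynomial (Fin 3) ℝ,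
      (∀ i, p i ∈ polyLE 3 (n - 1)) ∧ ∀ i, r i = pderiv i φ + wedge p i
  have hadd : ∀ r s, Q r → Q s → Q (r + s) := by
    rintro r s ⟨φ, hφ, p, hp, h⟩ ⟨ψ, hψ, q, hq, h'⟩
    refine ⟨_, add_mem hφ hψ, p + q, fun i => add_mem (hp i) (hq i), fun i => ?_⟩
    rw [Pi.add_apply, h, h', wedge_add, map_add, Pi.add_apply]
    ring
  have h0 : Q 0 := ⟨0, zero_mem _, 0, fun _ => zero_mem _, fun i => by
    fin_cases i <;> simp [wedge]⟩
  have hsingle : ∀ i, ∀ p ∈ polyLE 3 n, Q (Pi.single i p) := by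
    intro i p hp
    refine polyLE_induction (C := fun p => Q (Pi.single i p)) (by simpa using h0) ?_ ?_ hp
    · intro p q hp hq
      rw [Pi.single_add]
      exact hadd _ _ hp hq
    · intro s a hs
      refine exists_grad_add_wedge_of_homogeneous (m := s.degree) (fun j => ?_) (fun j => ?_)
      · rcases eq_or_ne j i with rfl | hj
        · rw [Pi.single_eq_same]
          exact isHomogeneous_monomial a rfl
        · rw [Pi.single_eq_of_ne hj]
          exact isHomogeneous_zero _ _ _
      · rcases eq_or_ne j i with rfl | hj
        · rw [Pi.single_eq_same]
          exact monomial_mem_polyLE hs a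
        · rw [Pi.single_eq_of_ne hj]
          exact zero_mem _
  have hsum : r = ∑ i, Pi.single i (r i) := (Finset.univ_sum_single r).symm
  have : Q r := by
    rw [hsum]
    exact Finset.sum_induction _ Q hadd h0 fun i _ => hsingle i _ (hr i)
  exact this

end Degree

/-! ### Linear combinations of degrees of freedom and solutions of linear systems. -/

namespace Polyhedron

variable (P : Polyhedron) (k : ℕ) (t : Fin P.nE → Fin (k - 1) → ℝ)

/-- The functionals on `V_h(P)` which are linear combinations of degrees of freedom. -/
def dofSpan : Submodule ℝ (P.space k → ℝ) :=
  Submodule.span ℝ (range fun (j : P.DofIndex k) (v : P.space k) => P.dof k t v j)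

variable {P k t}

theorem dof_mem_dofSpan (j : P.DofIndex k) :
    (fun v : P.space k => P.dof k t v j) ∈ P.dofSpan k t :=
  Submodule.subset_span ⟨j, rfl⟩

theorem mem_dofSpan_iff {L : P.space k → ℝ} :
    L ∈ P.dofSpan k t ↔
      ∃ c : P.DofIndex k →₀ ℝ, ∀ v : P.space k, c.sum (fun j a => a * P.dof k t v j) = L v := by
  rw [dofSpan, Finsupp.mem_span_range_iff_exists_finsupp]
  refine exists_congr fun c => ?_
  rw [funext_iff]
  simp [Finsupp.sum, Finset.sum_apply]

theorem sum_mem_dofSpan {ι : Type*} (J : Finset ι) {L : ι → P.space k → ℝ}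
    (h : ∀ j ∈ J, L j ∈ P.dofSpan k t) : (fun v => ∑ j ∈ J, L j v) ∈ P.dofSpan k t := by
  convert Submodule.sum_mem _ h using 1
  ext v
  simp

theorem mul_mem_dofSpan (a : ℝ) {L : P.space k → ℝ} (h : L ∈ P.dofSpan k t) :
    (fun v => a * L v) ∈ P.dofSpan k t :=
  Submodule.smul_mem _ a h

theorem sub_mem_dofSpan {L L' : P.space k → ℝ} (h : L ∈ P.dofSpan k t) (h' : L' ∈ P.dofSpan k t) :
    (fun v => L v - L' v) ∈ P.dofSpan k t :=
  sub_mem h h'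

theorem add_mem_dofSpan {L L' : P.space k → ℝ} (h : L ∈ P.dofSpan k t) (h' : L' ∈ P.dofSpan k t) :
    (fun v => L v + L' v) ∈ P.dofSpan k t :=
  add_mem h h'

/-- The evaluation of `M`-valued combinations of degrees of freedom. -/
def dofEval (t : Fin P.nE → Fin (k - 1) → ℝ) {M : Type*} [AddCommGroup M] [Module ℝ M]
    (v : E 3 → E 3) : (P.DofIndex k →₀ M) →ₗ[ℝ] M :=
  Finsupp.lsum ℝ fun j => P.dof k t v j • LinearMap.id

theorem dofEval_apply {M : Type*} [AddCommGroup M] [Module ℝ M] (v : E 3 → E 3)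
    (c : P.DofIndex k →₀ M) : dofEval t v c = c.sum fun j a => P.dof k t v j • a := by
  simp [dofEval]
  rfl

theorem dofEval_map {M M' : Type*} [AddCommGroup M] [Module ℝ M] [AddCommGroup M'] [Module ℝ M']
    (T : M →ₗ[ℝ] M') (v : E 3 → E 3) (c : P.DofIndex k →₀ M) :
    dofEval t v (Finsupp.mapRange.linearMap T c) = T (dofEval t v c) := by
  rw [dofEval_apply, dofEval_apply, Finsupp.mapRange.linearMap_apply,
    Finsupp.sum_mapRange_index (by simp), map_finsuppSum]
  simp

theorem computable_iff {M : Type*} [AddCommGroup M] [Module ℝ M] {R : (E 3 → E 3) → M → Prop} :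
    P.Computable k t R ↔ ∃ c : P.DofIndex k →₀ M, ∀ v ∈ P.space k, ∀ m, R v m ↔ m = dofEval t v c := by
  simp only [dofEval_apply]
  rfl

theorem Computable.pi {ι : Type*} [Finite ι] {M : ι → Type*} [∀ i, AddCommGroup (M i)]
    [∀ i, Module ℝ (M i)] {R : ∀ i, (E 3 → E 3) → M i → Prop} (h : ∀ i, P.Computable k t (R i)) :
    P.Computable k t fun v (p : ∀ i, M i) => ∀ i, R i v (p i) := by
  classical
  have := Fintype.ofFinite ι
  simp only [computable_iff] at h ⊢
  choose c hc using h
  refine ⟨∑ i, Finsupp.mapRange.linearMap (LinearMap.single ℝ M i) (c i), fun v hv p => ?_⟩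
  rw [map_sum, forall_congr' fun i => hc i v hv (p i), funext_iff]
  refine forall_congr' fun i => ?_
  simp only [dofEval_map, Finset.sum_apply, LinearMap.coe_single]
  rw [Finset.sum_eq_single i (fun j _ hj => Pi.single_eq_of_ne hj.symm _) (by simp),
    Pi.single_eq_same]

/-- This is how a projection already computed re-enters later moments: any linear functional of it
is again a combination of degrees of freedom. -/
theorem Computable.exists_eq {M : Type*} [AddCommGroup M] [Module ℝ M]
    {R : (E 3 → E 3) → M → Prop} (h : P.Computable k t R) :
    ∃ m : P.space k → M, (∀ (v : P.space k) (p : M), R v p ↔ p = m v) ∧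
      ∀ Λ : M →ₗ[ℝ] ℝ, (fun v => Λ (m v)) ∈ P.dofSpan k t := by
  rw [computable_iff] at h
  obtain ⟨c, hc⟩ := h
  refine ⟨fun v => dofEval t v c, fun v => hc v v.2, fun Λ => ?_⟩
  rw [mem_dofSpan_iff]
  refine ⟨Finsupp.mapRange.linearMap Λ c, fun v => ?_⟩
  rw [← dofEval_map, dofEval_apply]
  simp [mul_comm]

/-- The solution of a nondegenerate finite-dimensional linear system whose right-hand side is
computable is computable. -/
theorem computable_of_bilin {M : Type*} [AddCommGroup M] [Module ℝ M] {W : Submodule ℝ M}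
    [FiniteDimensional ℝ W] (B : M →ₗ[ℝ] M →ₗ[ℝ] ℝ)
    (hB : ∀ p ∈ W, (∀ q ∈ W, B q p = 0) → p = 0) {ℓ : P.space k → M →ₗ[ℝ] ℝ}
    (hℓ : ∀ q ∈ W, (fun v => ℓ v q) ∈ P.dofSpan k t) {R : (E 3 → E 3) → M → Prop}
    (hR : ∀ (v : P.space k) (m : M), R v m ↔ m ∈ W ∧ ∀ q ∈ W, B q m = ℓ v q) :
    P.Computable k t R := by
  set Φ₀ : W →ₗ[ℝ] Module.Dual ℝ W :=
    (LinearMap.lcomp ℝ ℝ W.subtype).comp (B.flip.domRestrict W)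
  have hΦ₀ : ∀ p q : W, Φ₀ p q = B q p := fun p q => rfl
  have hinj : Function.Injective Φ₀ := by
    rw [injective_iff_map_eq_zero]
    intro p hp
    refine Subtype.ext (hB p p.2 fun q hq => ?_)
    rw [← hΦ₀ p ⟨q, hq⟩, hp, LinearMap.zero_apply]
  let Φ : W ≃ₗ[ℝ] Module.Dual ℝ W :=
    LinearEquiv.ofInjectiveOfFinrankEq Φ₀ hinj Subspace.dual_finrank_eq.symm
  have hΦ : ∀ p q : W, Φ p q = B q p := fun p q => rfl
  let b := Module.finBasis ℝ W
  have hex : ∀ i, ∃ c : P.DofIndex k →₀ ℝ, ∀ v : P.space k,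
      c.sum (fun j a => a * P.dof k t v j) = ℓ v (b i) :=
    fun i => mem_dofSpan_iff.1 (hℓ _ (b i).2)
  choose c hc using hex
  rw [computable_iff]
  -- The right-hand side expands as `∑ i, ℓ v (b i) • b.coord i`. Solving the system once for each
  -- `b.coord i` gives polynomials independent of `v`, to be multiplied by the scalar coefficients
  -- of `ℓ v (b i)`.
  refine ⟨∑ i, Finsupp.mapRange.linearMap
    (LinearMap.toSpanSingleton ℝ M (Φ.symm (b.coord i))) (c i), fun v hv m => ?_⟩
  have hval : dofEval t v (∑ i, Finsupp.mapRange.linearMap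
      (LinearMap.toSpanSingleton ℝ M (Φ.symm (b.coord i))) (c i)) =
      (Φ.symm ((ℓ ⟨v, hv⟩).comp W.subtype) : W) := by
    have h1 : (ℓ ⟨v, hv⟩).comp W.subtype = ∑ i, ℓ ⟨v, hv⟩ (b i) • b.coord i := by
      refine b.ext fun j => ?_
      simp [Finsupp.single_apply]
    rw [map_sum, h1, map_sum, Submodule.coe_sum]
    refine Finset.sum_congr rfl fun i _ => ?_
    rw [dofEval_map, map_smul, Submodule.coe_smul, LinearMap.toSpanSingleton_apply, ← hc i,
      dofEval_apply]
    simp [mul_comm]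
  rw [hval, hR ⟨v, hv⟩ m]
  constructor
  · rintro ⟨hm, h⟩
    have : (⟨m, hm⟩ : W) = Φ.symm ((ℓ ⟨v, hv⟩).comp W.subtype) := by
      rw [LinearEquiv.eq_symm_apply]
      ext q
      rw [hΦ]
      exact h q q.2
    rw [← this]
  · rintro rfl
    refine ⟨Submodule.coe_mem _, fun q hq => ?_⟩
    rw [← hΦ _ ⟨q, hq⟩, LinearEquiv.apply_symm_apply]
    rfl

end Polyhedron

/-! ### Projections are computable once their moments are. -/

section PolyIntegral

variable {d : ℕ}

theorem integrable_mul_ev {μ : Measure (E d)} {K : Set (E d)} (hK : Bornology.IsBounded K)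
    (hμ : ∀ᵐ x ∂μ, x ∈ K) {w : E d → ℝ} (hw : Integrable w μ) (q : MvPolynomial (Fin d) ℝ) :
    Integrable (fun x => w x * ev q x) μ := by
  obtain ⟨C, hC⟩ := hK.isCompact_closure.exists_bound_of_continuousOn (continuous_ev q).continuousOn
  exact hw.mul_bdd (c := C) (continuous_ev q).aestronglyMeasurable
    (hμ.mono fun x hx => hC x (subset_closure hx))

/-- The functional `q ↦ ∫ w q` on polynomials. -/
def polyInt (μ : Measure (E d)) (w : E d → ℝ)
    (h : ∀ q : MvPolynomial (Fin d) ℝ, Integrable (fun x => w x * ev q x) μ) :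
    MvPolynomial (Fin d) ℝ →ₗ[ℝ] ℝ where
  toFun q := ∫ x, w x * ev q x ∂μ
  map_add' p q := by
    simp only [ev_add, mul_add]
    exact integral_add (h p) (h q)
  map_smul' a p := by
    simp only [ev_smul, RingHom.id_apply, smul_eq_mul]
    rw [← integral_const_mul]
    congr 1
    ext x
    ring

namespace Polyhedron

variable {P : Polyhedron} {k : ℕ} {t : Fin P.nE → Fin (k - 1) → ℝ}
  {O : Set (E d)}

theorem integrableOn_mul_ev (hO : IsOpen O) (hb : Bornology.IsBounded O) {w : E d → ℝ} (hw : MemLp w 2 (volume.restrict O))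
    (q : MvPolynomial (Fin d) ℝ) : IntegrableOn (fun x => w x * ev q x) O := by
  have hfin : IsFiniteMeasure (volume.restrict O) := ⟨by
    rw [Measure.restrict_apply_univ]; exact hb.measure_lt_top⟩
  exact integrable_mul_ev hb (ae_restrict_mem hO.measurableSet) (hw.integrable (by simp)) q

theorem integrableOn_ev (hb : Bornology.IsBounded O) (q : MvPolynomial (Fin d) ℝ) : IntegrableOn (ev q) O :=
  (continuous_ev q).integrableOn_of_isBounded hb

theorem ev_eq_zero_of_integral_sq (hO : IsOpen O) (hne : O.Nonempty) (hb : Bornology.IsBounded O) {q : MvPolynomial (Fin d) ℝ}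
    (h : ∫ x in O, ev q x * ev q x = 0) : q = 0 := by
  refine eq_zero_of_ev_eq_zero hO hne ?_
  rw [setIntegral_eq_zero_iff_of_nonneg_ae (Eventually.of_forall fun x => mul_self_nonneg _)] at h
  · intro x hx
    have h2 := (Measure.eqOn_open_of_ae_eq (f := fun x => ev q x * ev q x) (g := 0) h hO
      ((continuous_ev q).mul (continuous_ev q)).continuousOn continuousOn_const) hx
    exact mul_self_eq_zero.1 h2
  · exact ((continuous_ev q).mul (continuous_ev q)).integrableOn_of_isBounded hb

/-- The `L²` product is definite on polynomials, since a polynomial vanishing on a nonempty open set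
is zero. -/
theorem computable_l2Proj (hO : IsOpen O) (hne : O.Nonempty) (hb : Bornology.IsBounded O) {n : ℤ} {w : (E 3 → E 3) → E d → ℝ}
    (hw : ∀ v ∈ P.space k, MemLp (w v) 2 (volume.restrict O))
    (h : ∀ q ∈ polyLE d n, (fun v : P.space k => ∫ x in O, w v x * ev q x) ∈ P.dofSpan k t) :
    P.Computable k t fun v (p : MvPolynomial (Fin d) ℝ) => IsL2Proj O n (w v) p := by
  have h1 : ∀ q : MvPolynomial (Fin d) ℝ,
      Integrable (fun x => (1 : ℝ) * ev q x) (volume.restrict O) := fun q => by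
    simp only [one_mul]
    exact integrableOn_ev hb q
  set I := polyInt (volume.restrict O) (fun _ => 1) h1
  refine computable_of_bilin (W := polyLE d n) ((LinearMap.mul ℝ _).compr₂ I)
    (fun p hp hp0 => ev_eq_zero_of_integral_sq hO hne hb ?_)
    (ℓ := fun v => polyInt (volume.restrict O) (w v)
      (integrableOn_mul_ev hO hb (hw v v.2))) h fun v m => ?_
  · have := hp0 p hp
    simpa [I, polyInt] using this
  · refine and_congr_right fun hm => forall₂_congr fun q hq => ?_
    have e1 : ∀ x, ev q x * (w v x - ev m x) = w v x * ev q x - ev (q * m) x := fun x => by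
      rw [ev_mul]; ring
    simp only [e1]
    rw [integral_sub (integrableOn_mul_ev hO hb (hw v v.2) q) (integrableOn_ev hb _), sub_eq_zero]
    simp only [LinearMap.compr₂_apply, LinearMap.mul_apply', I, polyInt, LinearMap.coe_mk,
      AddHom.coe_mk, one_mul]
    exact eq_comm

theorem computable_nablaProj (hO : IsOpen O) (hne : O.Nonempty) (hb : Bornology.IsBounded O) {σ : Measure (E d)} [IsFiniteMeasure σ] (hσ : σ.real univ ≠ 0)
    {K : Set (E d)} (hK : Bornology.IsBounded K) (hσK : ∀ᵐ x ∂σ, x ∈ K) {n : ℤ} (hn : 0 ≤ n)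
    {w : (E 3 → E 3) → E d → ℝ}
    (hw : ∀ v ∈ P.space k, MemH1 O (w v)) (hwσ : ∀ v ∈ P.space k, MemLp (w v) 2 σ)
    (h : ∀ q ∈ polyLE d n, ∀ i, (fun v : P.space k => ∫ x in O, weakDeriv O i (w v) x *
      ev (MvPolynomial.pderiv i q) x) ∈ P.dofSpan k t)
    (hbd : (fun v : P.space k => ∫ x, w v x ∂σ) ∈ P.dofSpan k t) :
    P.Computable k t fun v (p : MvPolynomial (Fin d) ℝ) => IsNablaProj O σ n (w v) p := by
  have h1 : ∀ q : MvPolynomial (Fin d) ℝ,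
      Integrable (fun x => (1 : ℝ) * ev q x) (volume.restrict O) := fun q => by
    simp only [one_mul]
    exact integrableOn_ev hb q
  have h1σ : ∀ q : MvPolynomial (Fin d) ℝ, Integrable (fun x => (1 : ℝ) * ev q x) σ :=
    integrable_mul_ev hK hσK (integrable_const _)
  set I := polyInt (volume.restrict O) (fun _ => 1) h1
  have hI : ∀ q, I q = ∫ x in O, ev q x := fun q => by simp [I, polyInt]
  set S := polyInt σ (fun _ => 1) h1σ
  have hS : ∀ q, S q = ∫ x, ev q x ∂σ := fun q => by simp [S, polyInt]
  have hS1 : S 1 = σ.real univ := by simp [hS]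
  -- Adding the product of boundary integrals merges the gradient equations and the normalisation
  -- into one system. The form is definite: a vanishing gradient part leaves a constant, which the
  -- boundary integral `S` then kills.
  set B : MvPolynomial (Fin d) ℝ →ₗ[ℝ] MvPolynomial (Fin d) ℝ →ₗ[ℝ] ℝ :=
    ∑ i, ((LinearMap.mul ℝ _).compr₂ I).compl₁₂ (MvPolynomial.pderiv i).toLinearMap
      (MvPolynomial.pderiv i).toLinearMap + (LinearMap.mul ℝ ℝ).compl₁₂ S S
  have hB : ∀ q p, B q p = ∑ i, I (MvPolynomial.pderiv i q * MvPolynomial.pderiv i p) + S q * S p :=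
    fun q p => by simp [B]
  set G : P.space k → MvPolynomial (Fin d) ℝ →ₗ[ℝ] ℝ := fun v =>
    ∑ i, (polyInt (volume.restrict O) (weakDeriv O i (w v))
      (integrableOn_mul_ev hO hb ((hw v v.2).2 i).2)).comp (MvPolynomial.pderiv i).toLinearMap
  have hG : ∀ v q, G v q = ∑ i, ∫ x in O, weakDeriv O i (w v) x *
      ev (MvPolynomial.pderiv i q) x := fun v q => by
    simp only [G, LinearMap.sum_apply]
    rfl
  refine computable_of_bilin (W := polyLE d n) B (fun p hp hp0 => ?_)
    (ℓ := fun v => G v + (∫ x, w v x ∂σ) • S) (fun q hq => ?_) fun v m => ?_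
  · have hpp := hp0 p hp
    rw [hB] at hpp
    have hnn : ∀ i, 0 ≤ I (MvPolynomial.pderiv i p * MvPolynomial.pderiv i p) := fun i => by
      rw [hI]
      exact integral_nonneg fun x => by rw [ev_mul]; exact mul_self_nonneg _
    have hsum := Finset.sum_nonneg fun i (_ : i ∈ Finset.univ) => hnn i
    have hSp : S p = 0 := mul_self_eq_zero.1 (by nlinarith [mul_self_nonneg (S p)])
    have hsum0 : ∑ i, I (MvPolynomial.pderiv i p * MvPolynomial.pderiv i p) = 0 := by
      rw [hSp, mul_zero, add_zero] at hpp
      exact hpp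
    obtain ⟨a, rfl⟩ := eq_C_of_pderiv_eq_zero (p := p) fun i => by
      have := (Finset.sum_eq_zero_iff_of_nonneg fun i _ => hnn i).1 hsum0 i (Finset.mem_univ i)
      rw [hI] at this
      exact ev_eq_zero_of_integral_sq hO hne hb (by simpa only [ev_mul] using this)
    rw [hS] at hSp
    simp only [ev_C, integral_const, smul_eq_mul] at hSp
    rw [(mul_eq_zero.1 hSp).resolve_left hσ, map_zero]
  · simp only [LinearMap.add_apply, LinearMap.smul_apply, hG, smul_eq_mul]
    refine add_mem_dofSpan (sum_mem_dofSpan _ fun i _ => h q hq i) ?_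
    simpa only [mul_comm] using mul_mem_dofSpan (S q) hbd
  · refine and_congr_right fun hm => ?_
    have e1 : ∀ q, ∫ x in O, ∑ i, ev (MvPolynomial.pderiv i q) x *
        (weakDeriv O i (w v) x - ev (MvPolynomial.pderiv i m) x) =
        G v q - ∑ i, I (MvPolynomial.pderiv i q * MvPolynomial.pderiv i m) := fun q => by
      have e2 : ∀ i x, ev (MvPolynomial.pderiv i q) x *
        (weakDeriv O i (w v) x - ev (MvPolynomial.pderiv i m) x) =
          weakDeriv O i (w v) x * ev (MvPolynomial.pderiv i q) x -
            ev (MvPolynomial.pderiv i q * MvPolynomial.pderiv i m) x := fun i x => by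
        rw [ev_mul]; ring
      have hi : ∀ i, IntegrableOn (fun x => weakDeriv O i (w v) x *
          ev (MvPolynomial.pderiv i q) x) O :=
        fun i => integrableOn_mul_ev hO hb ((hw v v.2).2 i).2 _
      simp only [e2]
      rw [integral_finsetSum _ fun i _ => (hi i).fun_sub (integrableOn_ev hb _), hG,
        ← Finset.sum_sub_distrib]
      refine Finset.sum_congr rfl fun i _ => ?_
      rw [integral_sub (hi i) (integrableOn_ev hb _), hI]
    have e3 : ∫ x, (w v x - ev m x) ∂σ = (∫ x, w v x ∂σ) - S m := by
      rw [hS, integral_sub ((hwσ v v.2).integrable (by simp)) (by simpa using h1σ m)]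
    simp only [e1, e3, hB, LinearMap.add_apply, LinearMap.smul_apply, smul_eq_mul, sub_eq_zero]
    constructor
    · rintro ⟨h2, h3⟩ q hq
      rw [h2 q hq, h3, mul_comm]
    · intro h2
      -- Testing with `1` removes the gradient part and recovers the boundary condition because `S 1
      -- ≠ 0`; the gradient equations follow by subtraction.
      have h4 := h2 1 (one_mem_polyLE hn)
      have hG1 : G v 1 = 0 := by simp [hG]
      simp only [hG1, hS1, MvPolynomial.pderiv_one, zero_mul, map_zero, Finset.sum_const_zero,
        zero_add] at h4
      have h5 : ∫ x, w v x ∂σ = S m := mul_left_cancel₀ hσ (by linarith)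
      refine ⟨fun q hq => ?_, h5⟩
      have := h2 q hq
      rw [h5] at this
      linarith

end Polyhedron

end PolyIntegral

/-! ### Edge integrals, face moments and face projections. -/

namespace Polyhedron

variable {P : Polyhedron} {k : ℕ} {t : Fin P.nE → Fin (k - 1) → ℝ}

theorem memH1_of_space (v : P.space k) (i : Fin 3) : MemH1 P.carrier (fun x => v.1 x i) :=
  (v.2.1 i).1

theorem hasTrace_of_space (v : P.space k) (i : Fin 3) :
    HasTrace P.carrier P.surf (fun x => v.1 x i) (fun x => v.1 x i) :=
  (v.2.1 i).2

theorem onFace_mem_faceSpace (v : P.space k) (f : Fin P.nF) (i : Fin 3) :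
    P.onFace f v.1 i ∈ P.faceSpace k f :=
  v.2.2.2.1 f i

theorem memH1_onFace (v : P.space k) (f : Fin P.nF) (i : Fin 3) :
    MemH1 (P.region f) (P.onFace f v.1 i) :=
  (onFace_mem_faceSpace v f i).1

theorem hasTrace_onFace (v : P.space k) (f : Fin P.nF) (i : Fin 3) :
    HasTrace (P.region f) (P.faceBdry f) (P.onFace f v.1 i) (P.onFace f v.1 i) :=
  (onFace_mem_faceSpace v f i).2.1

theorem chart_planeCoord_edgePt {f : Fin P.nF} {e : Fin P.nE} (he : e ∈ P.bdry f) (s : ℝ) :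
    P.chart f (planeCoord (P.chart f) (P.edgePt e s)) = P.edgePt e s := by
  rw [planeCoord_edgePt he, chart_lineMap he]

theorem exists_polynomial_edge (v : P.space k) (e : Fin P.nE) (i : Fin 3) :
    ∃ q : Polynomial ℝ, q.natDegree ≤ k ∧ ∀ s ∈ Icc (0 : ℝ) 1, v.1 (P.edgePt e s) i = q.eval s := by
  obtain ⟨f, he⟩ := P.edge_mem_face e
  obtain ⟨q, hq, h⟩ := (onFace_mem_faceSpace v f i).2.2.2.1 e he
  refine ⟨q, hq, fun s hs => ?_⟩
  rw [← h s hs, onFace, chart_planeCoord_edgePt he]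

/-- The interpolation nodes of an edge: the endpoints and the interior points. -/
def edgeNode (t : Fin P.nE → Fin (k - 1) → ℝ) (e : Fin P.nE) : Option (Option (Fin (k - 1))) → ℝ
  | none => 0
  | some none => 1
  | some (some j) => t e j

theorem edgeNode_mem (ht : ∀ e j, t e j ∈ Ioo (0 : ℝ) 1) (e : Fin P.nE)
    (n : Option (Option (Fin (k - 1)))) : edgeNode t e n ∈ Icc (0 : ℝ) 1 := by
  rcases n with _ | _ | j
  · simp [edgeNode]
  · simp [edgeNode]
  · exact Ioo_subset_Icc_self (ht e j)

theorem edgeNode_injective (ht : ∀ e j, t e j ∈ Ioo (0 : ℝ) 1)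
    (ht' : ∀ e, Function.Injective (t e)) (e : Fin P.nE) : Function.Injective (edgeNode t e) := by
  rintro (_ | _ | j) (_ | _ | j') h <;> simp only [edgeNode] at h
  · rfl
  · norm_num at h
  · exact absurd h (ht e j').1.ne
  · norm_num at h
  · rfl
  · exact absurd h (ht e j').2.ne'
  · exact absurd h (ht e j).1.ne'
  · exact absurd h (ht e j).2.ne
  · rw [ht' e h]

theorem edgeNode_value_mem_dofSpan (e : Fin P.nE) (n : Option (Option (Fin (k - 1)))) (i : Fin 3) :
    (fun v : P.space k => v.1 (P.edgePt e (edgeNode t e n)) i) ∈ P.dofSpan k t := by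
  rcases n with _ | _ | j
  · simpa [edgeNode, edgePt, dof] using dof_mem_dofSpan (t := t) (.vertex (P.src e) i)
  · simpa [edgeNode, edgePt, dof] using dof_mem_dofSpan (t := t) (.vertex (P.tgt e) i)
  · exact dof_mem_dofSpan (t := t) (.edge e j i)

theorem edge_integral_mem_dofSpan (hk : 2 ≤ k) (ht : ∀ e j, t e j ∈ Ioo (0 : ℝ) 1)
    (ht' : ∀ e, Function.Injective (t e)) (e : Fin P.nE) (i : Fin 3) {g : ℝ → ℝ}
    (hg : Continuous g) :
    (fun v : P.space k => ∫ s in Icc (0 : ℝ) 1, v.1 (P.edgePt e s) i * g s) ∈ P.dofSpan k t := by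
  set L := fun n => Lagrange.basis Finset.univ (edgeNode t e) n
  have hL : ∀ n, Continuous fun s => (L n).eval s * g s := fun n => (L n).continuous.mul hg
  have heq : ∀ v : P.space k, ∫ s in Icc (0 : ℝ) 1, v.1 (P.edgePt e s) i * g s =
      ∑ n, (∫ s in Icc (0 : ℝ) 1, (L n).eval s * g s) * v.1 (P.edgePt e (edgeNode t e n)) i := by
    intro v
    obtain ⟨q, hq, h⟩ := exists_polynomial_edge v e i
    -- The two endpoints and the `k - 1` interior points are `k + 1` nodes, enough to interpolate
    -- degree `k` exactly.
    have hdeg : q.degree < (Finset.univ : Finset (Option (Option (Fin (k - 1))))).card := by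
      refine lt_of_le_of_lt q.degree_le_natDegree ?_
      simp only [Finset.card_univ, Fintype.card_option, Fintype.card_fin]
      exact_mod_cast (by omega : q.natDegree < k - 1 + 1 + 1)
    have hint := Lagrange.eq_interpolate (edgeNode_injective ht ht' e).injOn hdeg
    have hval : ∀ s ∈ Icc (0 : ℝ) 1, v.1 (P.edgePt e s) i * g s =
        ∑ n, v.1 (P.edgePt e (edgeNode t e n)) i * ((L n).eval s * g s) := by
      intro s hs
      rw [h s hs]
      conv_lhs => rw [hint, Lagrange.interpolate_apply, Polynomial.eval_finsetSum,
        Finset.sum_mul]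
      refine Finset.sum_congr rfl fun n _ => ?_
      rw [Polynomial.eval_mul, Polynomial.eval_C, ← h _ (edgeNode_mem ht e n)]
      ring
    rw [setIntegral_congr_fun measurableSet_Icc hval, integral_finsetSum]
    · refine Finset.sum_congr rfl fun n _ => ?_
      rw [integral_const_mul, mul_comm]
    · exact fun n _ => (((hL n).const_mul _).integrableOn_of_isBounded (Metric.isBounded_Icc 0 1))
  rw [funext heq]
  exact sum_mem_dofSpan _ fun n _ => mul_mem_dofSpan _ (edgeNode_value_mem_dofSpan e n i)

theorem onFace_edge_integral_mem_dofSpan (hk : 2 ≤ k) (ht : ∀ e j, t e j ∈ Ioo (0 : ℝ) 1)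
    (ht' : ∀ e, Function.Injective (t e)) {f : Fin P.nF} {e : Fin P.nE} (he : e ∈ P.bdry f)
    (i : Fin 3) (q : MvPolynomial (Fin 2) ℝ) :
    (fun v : P.space k => ∫ s in Icc (0 : ℝ) 1,
      P.onFace f v.1 i (planeCoord (P.chart f) (P.edgePt e s)) *
        ev q (planeCoord (P.chart f) (P.edgePt e s))) ∈ P.dofSpan k t := by
  have hc : Continuous fun s => ev q (planeCoord (P.chart f) (P.edgePt e s)) := by
    simp only [planeCoord_edgePt he]
    exact (continuous_ev q).comp AffineMap.lineMap_continuous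
  simpa only [onFace, chart_planeCoord_edgePt he] using edge_integral_mem_dofSpan hk ht ht' e i hc

/-- The face degrees of freedom use the frame `(n, τ₁, τ₂)`; expanding a Cartesian component in this
frame expresses its moments through them. -/
theorem face_moment_low_mem_dofSpan (f : Fin P.nF) (i : Fin 3) {p : MvPolynomial (Fin 2) ℝ}
    (hp : p ∈ polyLE 2 ((k : ℤ) - 2)) :
    (fun v : P.space k => ∫ y in P.region f, P.onFace f v.1 i y * ev p y) ∈ P.dofSpan k t := by
  have heq : ∀ v : P.space k, ∫ y in P.region f, P.onFace f v.1 i y * ev p y =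
      ∑ c, planeFrame (P.chart f) c i * P.dof k t v.1 (.face f c ⟨p, hp⟩) := by
    intro v
    simp only [dof]
    have hint : ∀ c, IntegrableOn (fun y =>
        inner ℝ (v.1 (P.chart f y)) (planeFrame (P.chart f) c) * ev p y) (P.region f) := by
      intro c
      have h1 : ∀ y, inner ℝ (v.1 (P.chart f y)) (planeFrame (P.chart f) c) * ev p y =
          ∑ j, planeFrame (P.chart f) c j * (P.onFace f v.1 j y * ev p y) := fun y => by
        simp only [PiLp.inner_apply, onFace, Finset.sum_mul]
        refine Finset.sum_congr rfl fun j _ => ?_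
        simp
        ring
      simp only [h1]
      exact integrable_finsetSum _ fun j _ => (integrableOn_mul_ev (P.region_isOpen f)
        (P.region_isBounded f) (memH1_onFace v f j).1 p).const_mul _
    simp only [← integral_const_mul]
    rw [← integral_finsetSum _ fun c _ => (hint c).const_mul _]
    congr 1
    ext y
    rw [onFace, eq_sum_planeFrame (P.chart f) (v.1 (P.chart f y)) i, Finset.sum_mul]
    exact Finset.sum_congr rfl fun c _ => by ring
  rw [funext heq]
  exact sum_mem_dofSpan _ fun c _ => mul_mem_dofSpan _ (dof_mem_dofSpan _)

/-- After integration by parts, the volume term involves second derivatives of `q`, of degree at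
most `k - 2`, and the boundary terms are edge integrals. -/
theorem computable_face_nablaProj {ρ : ℝ} (hρ : 0 < ρ) (hP : P.ShapeRegular ρ) (hk : 2 ≤ k)
    (ht : ∀ e j, t e j ∈ Ioo (0 : ℝ) 1) (ht' : ∀ e, Function.Injective (t e)) (f : Fin P.nF)
    (i : Fin 3) :
    P.Computable k t fun v (p : MvPolynomial (Fin 2) ℝ) =>
      IsNablaProj (P.region f) (P.faceBdry f) k (P.onFace f v i) p := by
  refine computable_nablaProj (P.region_isOpen f) (P.region_isConnected f).nonempty
    (P.region_isBounded f) (faceBdry_ne_zero f) (isBounded_frontier_region f) (ae_faceBdry_mem f)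
    (by positivity) (w := fun v => P.onFace f v i) (fun v hv => memH1_onFace ⟨v, hv⟩ f i)
    (fun v hv => (hasTrace_onFace ⟨v, hv⟩ f i).1) (fun q hq j => ?_) ?_
  · obtain ⟨κ, hκ⟩ := face_green hρ hP f j
    have := fun v : P.space k => eq_sub_of_add_eq (hκ _ (memH1_onFace v f i)
      (hasTrace_onFace v f i) (MvPolynomial.pderiv j q))
    rw [funext this]
    refine sub_mem_dofSpan (sum_mem_dofSpan _ fun e he => mul_mem_dofSpan _
      (onFace_edge_integral_mem_dofSpan hk ht ht' he i _)) (face_moment_low_mem_dofSpan f i ?_)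
    exact pderiv_mem_polyLE_of_le (pderiv_mem_polyLE hq j) (by omega) j
  · have := fun v : P.space k => integral_faceBdry f
      ((hasTrace_onFace v f i).1.integrable (by simp))
    rw [funext this]
    refine sum_mem_dofSpan _ fun e he => mul_mem_dofSpan _ ?_
    simpa using onFace_edge_integral_mem_dofSpan hk ht ht' he i 1

theorem face_moment_mem_dofSpan {ρ : ℝ} (hρ : 0 < ρ) (hP : P.ShapeRegular ρ) (hk : 2 ≤ k)
    (ht : ∀ e j, t e j ∈ Ioo (0 : ℝ) 1) (ht' : ∀ e, Function.Injective (t e)) (f : Fin P.nF)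
    (i : Fin 3) {p : MvPolynomial (Fin 2) ℝ} (hp : p ∈ polyLE 2 ((k : ℤ) + 1)) :
    (fun v : P.space k => ∫ y in P.region f, P.onFace f v.1 i y * ev p y) ∈ P.dofSpan k t := by
  obtain ⟨p₁, hp₁, p₂, hp₂, rfl⟩ := exists_polyLE_add_polyHat ((k : ℤ) - 2) hp
  obtain ⟨m, hm, hΛ⟩ := (computable_face_nablaProj hρ hP hk ht ht' f i).exists_eq
  have hint : ∀ (v : P.space k) q, IntegrableOn (fun y => P.onFace f v.1 i y * ev q y)
      (P.region f) := fun v q => integrableOn_mul_ev (P.region_isOpen f)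
        (P.region_isBounded f) (memH1_onFace v f i).1 q
  have hone : ∀ q : MvPolynomial (Fin 2) ℝ, IntegrableOn (fun y => ev p₂ y * ev q y) (P.region f) :=
    fun q => ((continuous_ev p₂).mul (continuous_ev q)).integrableOn_of_isBounded
      (P.region_isBounded f)
  have heq : ∀ v : P.space k, ∫ y in P.region f, P.onFace f v.1 i y * ev (p₁ + p₂) y =
      (∫ y in P.region f, P.onFace f v.1 i y * ev p₁ y) +
        polyInt (volume.restrict (P.region f)) (ev p₂) hone (m v) := by
    intro v
    -- By uniqueness the projection `π` in the definition of the face space is the computed `m v`.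
    -- The orthogonality then trades the moment of `v` against `p₂` for that of `m v`.
    obtain ⟨π, hπ, h⟩ := (onFace_mem_faceSpace v f i).2.2.2.2.2
    rw [(hm v π).1 hπ] at h
    have h2 := h p₂ hp₂
    have e1 : ∀ y, (P.onFace f v.1 i y - ev (m v) y) * ev p₂ y =
      P.onFace f v.1 i y * ev p₂ y - ev p₂ y * ev (m v) y := fun y => by ring
    simp only [e1] at h2
    rw [integral_sub (hint v p₂) (hone _), sub_eq_zero] at h2
    simp only [ev_add, mul_add]
    rw [integral_add (hint v p₁) (hint v p₂), h2]
    rfl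
  rw [funext heq]
  exact add_mem_dofSpan (face_moment_low_mem_dofSpan f i hp₁) (hΛ _)

theorem computable_face_l2Proj {ρ : ℝ} (hρ : 0 < ρ) (hP : P.ShapeRegular ρ) (hk : 2 ≤ k)
    (ht : ∀ e j, t e j ∈ Ioo (0 : ℝ) 1) (ht' : ∀ e, Function.Injective (t e)) (f : Fin P.nF)
    (i : Fin 3) :
    P.Computable k t fun v (p : MvPolynomial (Fin 2) ℝ) =>
      IsL2Proj (P.region f) (k + 1) (P.onFace f v i) p :=
  computable_l2Proj (P.region_isOpen f) (P.region_isConnected f).nonempty (P.region_isBounded f)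
    (w := fun v => P.onFace f v i) (fun v hv => (memH1_onFace ⟨v, hv⟩ f i).1)
    fun _ hq => face_moment_mem_dofSpan hρ hP hk ht ht' f i hq

/-! ### Moments and projections in the element. -/

theorem exists_comp_chart {n : ℤ} (f : Fin P.nF) {p : MvPolynomial (Fin 3) ℝ}
    (hp : p ∈ polyLE 3 n) : ∃ q ∈ polyLE 2 n, ∀ y, ev p (P.chart f y) = ev q y := by
  refine exists_comp_mem_polyLE (l := fun i => MvPolynomial.C (P.chart f 0 i) +
    (planeFrame (P.chart f) 1 i • MvPolynomial.X 0 + planeFrame (P.chart f) 2 i • MvPolynomial.X 1))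
    (fun i => add_mem (C_mem_polyLE (by norm_num) _) (add_mem (Submodule.smul_mem _ _
      (X_mem_polyLE _)) (Submodule.smul_mem _ _ (X_mem_polyLE _)))) (fun y i => ?_) hp
  have h1 : P.chart f y = P.chart f 0 + (P.chart f).linearIsometry y := by
    have := (P.chart f).map_vadd 0 y
    simpa [add_comm] using this
  rw [h1, linearIsometry_apply_eq]
  simp
  ring

theorem boundary_moment_mem_dofSpan {ρ : ℝ} (hρ : 0 < ρ) (hP : P.ShapeRegular ρ) (hk : 2 ≤ k)
    (ht : ∀ e j, t e j ∈ Ioo (0 : ℝ) 1) (ht' : ∀ e, Function.Injective (t e)) (f : Fin P.nF)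
    (i : Fin 3) {p : MvPolynomial (Fin 3) ℝ} (hp : p ∈ polyLE 3 ((k : ℤ) + 1)) :
    (fun v : P.space k => ∫ y in P.region f, v.1 (P.chart f y) i * ev p (P.chart f y)) ∈
      P.dofSpan k t := by
  obtain ⟨q, hq, h⟩ := exists_comp_chart f hp
  simp only [h]
  exact face_moment_mem_dofSpan hρ hP hk ht ht' f i hq

/-- Integration by parts in the element: the sum of the two volume terms is a boundary term. -/
theorem green_mem_dofSpan {ρ : ℝ} (hρ : 0 < ρ) (hP : P.ShapeRegular ρ) (hk : 2 ≤ k)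
    (ht : ∀ e j, t e j ∈ Ioo (0 : ℝ) 1) (ht' : ∀ e, Function.Injective (t e)) (i j : Fin 3)
    {p : MvPolynomial (Fin 3) ℝ} (hp : p ∈ polyLE 3 ((k : ℤ) + 1)) :
    (fun v : P.space k => (∫ x in P.carrier, weakDeriv P.carrier j (fun y => v.1 y i) x * ev p x) +
      ∫ x in P.carrier, v.1 x i * ev (MvPolynomial.pderiv j p) x) ∈ P.dofSpan k t := by
  obtain ⟨κ, hκ⟩ := element_green hρ hP j
  have := fun v : P.space k => hκ _ (memH1_of_space v i) (hasTrace_of_space v i) p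
  rw [funext this]
  exact sum_mem_dofSpan _ fun f _ => mul_mem_dofSpan _
    (boundary_moment_mem_dofSpan hρ hP hk ht ht' f i hp)

theorem weakDeriv_moment_mem_dofSpan {ρ : ℝ} (hρ : 0 < ρ) (hP : P.ShapeRegular ρ) (hk : 2 ≤ k)
    (ht : ∀ e j, t e j ∈ Ioo (0 : ℝ) 1) (ht' : ∀ e, Function.Injective (t e)) (i j : Fin 3)
    {p : MvPolynomial (Fin 3) ℝ} (hp : p ∈ polyLE 3 ((k : ℤ) + 1))
    (h : (fun v : P.space k => ∫ x in P.carrier, v.1 x i * ev (MvPolynomial.pderiv j p) x) ∈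
      P.dofSpan k t) :
    (fun v : P.space k => ∫ x in P.carrier, weakDeriv P.carrier j (fun y => v.1 y i) x * ev p x) ∈
      P.dofSpan k t := by
  simpa using sub_mem_dofSpan (green_mem_dofSpan hρ hP hk ht ht' i j hp) h

theorem memLp_divP (v : P.space k) : MemLp (P.divP v.1) 2 (volume.restrict P.carrier) :=
  memLp_finsetSum _ fun i _ => ((memH1_of_space v i).2 i).2

theorem integral_divP_mul (v : P.space k) (p : MvPolynomial (Fin 3) ℝ) :
    ∫ x in P.carrier, P.divP v.1 x * ev p x =
      ∑ i, ∫ x in P.carrier, weakDeriv P.carrier i (fun y => v.1 y i) x * ev p x := by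
  simp only [divP, Finset.sum_mul]
  exact integral_finsetSum _ fun i _ =>
    integrableOn_mul_ev P.isOpen P.isBounded ((memH1_of_space v i).2 i).2 p

/-- There is no degree bound on `p`: the divergence is a polynomial of degree at most `k - 1`, so it
equals its own computable `L²`-projection. -/
theorem divP_moment_mem_dofSpan {ρ : ℝ} (hρ : 0 < ρ) (hP : P.ShapeRegular ρ) (hk : 2 ≤ k)
    (ht : ∀ e j, t e j ∈ Ioo (0 : ℝ) 1) (ht' : ∀ e, Function.Injective (t e))
    (p : MvPolynomial (Fin 3) ℝ) :
    (fun v : P.space k => ∫ x in P.carrier, P.divP v.1 x * ev p x) ∈ P.dofSpan k t := by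
  have hcomp : P.Computable k t fun v (p : MvPolynomial (Fin 3) ℝ) =>
      IsL2Proj P.carrier ((k : ℤ) - 1) (P.divP v) p := by
    refine computable_l2Proj P.isOpen P.isConnected.nonempty P.isBounded (w := P.divP)
      (fun v hv => memLp_divP ⟨v, hv⟩) fun q hq => ?_
    obtain ⟨q₁, hq₁, q₂, hq₂, rfl⟩ := exists_polyLE_add_polyHat 0 hq
    -- The divergence moments among the degrees of freedom omit constants; against a constant,
    -- Green's formula leaves only the boundary flux.
    obtain ⟨a, rfl⟩ := eq_C_of_mem_polyLE_zero hq₁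
    have hsplit : ∀ v : P.space k, ∫ x in P.carrier, P.divP v.1 x * ev (MvPolynomial.C a + q₂) x =
        (∫ x in P.carrier, P.divP v.1 x * ev (MvPolynomial.C a) x) +
          P.dof k t v.1 (.div ⟨q₂, hq₂⟩) := fun v => by
      simp only [ev_add, mul_add, dof]
      exact integral_add (integrableOn_mul_ev P.isOpen P.isBounded (memLp_divP v) _)
        (integrableOn_mul_ev P.isOpen P.isBounded (memLp_divP v) _)
    rw [funext hsplit]
    refine add_mem_dofSpan ?_ (dof_mem_dofSpan _)
    simp only [integral_divP_mul]
    refine sum_mem_dofSpan _ fun i _ => weakDeriv_moment_mem_dofSpan hρ hP hk ht ht' i i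
      (C_mem_polyLE (by positivity) a) ?_
    simp only [MvPolynomial.pderiv_C, ev_zero, mul_zero, integral_zero]
    exact zero_mem (P.dofSpan k t)
  obtain ⟨m, hm, hΛ⟩ := hcomp.exists_eq
  have hone : ∀ q : MvPolynomial (Fin 3) ℝ, IntegrableOn (fun y => ev p y * ev q y) P.carrier :=
    fun q => ((continuous_ev p).mul (continuous_ev q)).integrableOn_of_isBounded P.isBounded
  have heq : ∀ v : P.space k, ∫ x in P.carrier, P.divP v.1 x * ev p x =
      polyInt (volume.restrict P.carrier) (ev p) hone (m v) := by
    intro v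
    obtain ⟨q, hq, h⟩ := v.2.2.2.2.2.1
    have hqm : q = m v := (hm v q).1 ⟨hq, fun r _ => by
      rw [integral_congr_ae (g := fun _ => 0) (h.mono fun x hx => by simp [hx])]
      simp⟩
    rw [← hqm]
    refine integral_congr_ae (h.mono fun x hx => ?_)
    simp only [hx, mul_comm]
  rw [funext heq]
  exact hΛ _

theorem integrableOn_space_mul_ev (v : P.space k) (i : Fin 3) (p : MvPolynomial (Fin 3) ℝ) :
    IntegrableOn (fun x => v.1 x i * ev p x) P.carrier :=
  integrableOn_mul_ev P.isOpen P.isBounded (memH1_of_space v i).1 p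

/-- Summing Green's formula over `i = j` gives `∫ v·∇φ = boundary - ∫ (div v) φ`, where both terms
on the right are known. -/
theorem grad_moment_mem_dofSpan {ρ : ℝ} (hρ : 0 < ρ) (hP : P.ShapeRegular ρ) (hk : 2 ≤ k)
    (ht : ∀ e j, t e j ∈ Ioo (0 : ℝ) 1) (ht' : ∀ e, Function.Injective (t e))
    {φ : MvPolynomial (Fin 3) ℝ} (hφ : φ ∈ polyLE 3 ((k : ℤ) + 1)) :
    (fun v : P.space k => ∑ i, ∫ x in P.carrier, v.1 x i * ev (MvPolynomial.pderiv i φ) x) ∈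
      P.dofSpan k t := by
  have h1 := sub_mem_dofSpan (sum_mem_dofSpan Finset.univ fun i _ =>
    green_mem_dofSpan hρ hP hk ht ht' i i hφ) (divP_moment_mem_dofSpan hρ hP hk ht ht' φ)
  simpa [integral_divP_mul, Finset.sum_add_distrib] using h1

/-- A volume moment of a component of `v` is computable as soon as the moments against the
fields `x ∧ p` of the same degree are. -/
theorem moment_mem_dofSpan_of_wedge {ρ : ℝ} (hρ : 0 < ρ) (hP : P.ShapeRegular ρ) (hk : 2 ≤ k)
    (ht : ∀ e j, t e j ∈ Ioo (0 : ℝ) 1) (ht' : ∀ e, Function.Injective (t e)) {n : ℤ}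
    (hn : n ≤ k)
    (hwedge : ∀ p : Fin 3 → MvPolynomial (Fin 3) ℝ, (∀ i, p i ∈ polyLE 3 (n - 1)) →
      (fun v : P.space k => ∑ i, ∫ x in P.carrier, v.1 x i * ev (wedge p i) x) ∈ P.dofSpan k t)
    (i : Fin 3) {r : MvPolynomial (Fin 3) ℝ} (hr : r ∈ polyLE 3 n) :
    (fun v : P.space k => ∫ x in P.carrier, v.1 x i * ev r x) ∈ P.dofSpan k t := by
  have hr' : ∀ j, (Pi.single i r : Fin 3 → MvPolynomial (Fin 3) ℝ) j ∈ polyLE 3 n := fun j => by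
    rcases eq_or_ne j i with rfl | hj
    · rwa [Pi.single_eq_same]
    · rw [Pi.single_eq_of_ne hj]
      exact zero_mem _
  -- The potential `φ` has degree at most `n + 1 ≤ k + 1`, the highest degree for which boundary
  -- moments are available.
  obtain ⟨φ, hφ, p, hp, h⟩ := exists_grad_add_wedge hr'
  have hsum := add_mem_dofSpan (grad_moment_mem_dofSpan hρ hP hk ht ht'
    (polyLE_mono (by omega) hφ)) (hwedge p hp)
  convert hsum using 1
  ext v
  rw [← Finset.sum_add_distrib]
  have : ∀ j, (∫ x in P.carrier, v.1 x j * ev (MvPolynomial.pderiv j φ) x) +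
      ∫ x in P.carrier, v.1 x j * ev (wedge p j) x =
      ∫ x in P.carrier, v.1 x j * ev ((Pi.single i r : Fin 3 → MvPolynomial (Fin 3) ℝ) j) x :=
    fun j => by
      rw [← integral_add (integrableOn_space_mul_ev v j _) (integrableOn_space_mul_ev v j _), h j]
      simp only [ev_add, mul_add]
  simp only [this]
  rw [Finset.sum_eq_single i (fun j _ hj => by simp [Pi.single_eq_of_ne hj]) (by simp),
    Pi.single_eq_same]

theorem sum_integral_wedge (v : P.space k) (p : Fin 3 → MvPolynomial (Fin 3) ℝ) :
    ∑ i, ∫ x in P.carrier, v.1 x i * ev (wedge p i) x =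
      ∫ x in P.carrier, ∑ i, v.1 x i * xWedge p x i := by
  simp only [xWedge_eq]
  exact (integral_finsetSum _ fun i _ => integrableOn_space_mul_ev v i _).symm

theorem wedge_moment_low_mem_dofSpan {p : Fin 3 → MvPolynomial (Fin 3) ℝ}
    (hp : ∀ i, p i ∈ polyLE 3 ((k : ℤ) - 3)) :
    (fun v : P.space k => ∑ i, ∫ x in P.carrier, v.1 x i * ev (wedge p i) x) ∈ P.dofSpan k t := by
  simp only [sum_integral_wedge]
  exact dof_mem_dofSpan (t := t) (.volume fun i => ⟨p i, hp i⟩)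

theorem moment_low_mem_dofSpan {ρ : ℝ} (hρ : 0 < ρ) (hP : P.ShapeRegular ρ) (hk : 2 ≤ k)
    (ht : ∀ e j, t e j ∈ Ioo (0 : ℝ) 1) (ht' : ∀ e, Function.Injective (t e))
    (i : Fin 3) {r : MvPolynomial (Fin 3) ℝ} (hr : r ∈ polyLE 3 ((k : ℤ) - 2)) :
    (fun v : P.space k => ∫ x in P.carrier, v.1 x i * ev r x) ∈ P.dofSpan k t :=
  moment_mem_dofSpan_of_wedge hρ hP hk ht ht' (by omega)
    (fun _ hp => wedge_moment_low_mem_dofSpan fun i => polyLE_mono (by omega) (hp i)) i hr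

/-- As on a face, second derivatives of `q` have degree at most `k - 2`. Only the low moments enter,
so the orthogonality in `space` can afterwards be used without circularity. -/
theorem computable_nablaProj_element {ρ : ℝ} (hρ : 0 < ρ) (hP : P.ShapeRegular ρ) (hk : 2 ≤ k)
    (ht : ∀ e j, t e j ∈ Ioo (0 : ℝ) 1) (ht' : ∀ e, Function.Injective (t e)) (i : Fin 3) :
    P.Computable k t fun v (p : MvPolynomial (Fin 3) ℝ) =>
      IsNablaProj P.carrier P.surf k (fun x => v x i) p := by
  refine computable_nablaProj P.isOpen P.isConnected.nonempty P.isBounded surf_ne_zero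
    isBounded_frontier_carrier ae_surf_mem (by positivity) (w := fun v x => v x i)
    (fun v hv => memH1_of_space ⟨v, hv⟩ i) (fun v hv => (hasTrace_of_space ⟨v, hv⟩ i).1)
    (fun q hq j => ?_) ?_
  · refine weakDeriv_moment_mem_dofSpan hρ hP hk ht ht' i j
      (pderiv_mem_polyLE_of_le hq (by omega) j) (moment_low_mem_dofSpan hρ hP hk ht ht' i ?_)
    exact pderiv_mem_polyLE_of_le (pderiv_mem_polyLE hq j) (by omega) j
  · have := fun v : P.space k => integral_surf ((hasTrace_of_space v i).1.integrable (by simp))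
    rw [funext this]
    refine sum_mem_dofSpan _ fun f _ => ?_
    simpa using boundary_moment_mem_dofSpan hρ hP hk ht ht' f i
      (one_mem_polyLE (by positivity))

theorem wedge_moment_mem_dofSpan {ρ : ℝ} (hρ : 0 < ρ) (hP : P.ShapeRegular ρ) (hk : 2 ≤ k)
    (ht : ∀ e j, t e j ∈ Ioo (0 : ℝ) 1) (ht' : ∀ e, Function.Injective (t e))
    {p : Fin 3 → MvPolynomial (Fin 3) ℝ} (hp : ∀ i, p i ∈ polyLE 3 ((k : ℤ) - 1)) :
    (fun v : P.space k => ∑ i, ∫ x in P.carrier, v.1 x i * ev (wedge p i) x) ∈ P.dofSpan k t := by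
  choose p₁ hp₁ p₂ hp₂ hpp using fun i => exists_polyLE_add_polyHat ((k : ℤ) - 3) (hp i)
  have hp' : p = p₁ + p₂ := funext hpp
  choose m hm hΛ using fun i =>
    (computable_nablaProj_element hρ hP hk ht ht' i).exists_eq
  have hone : ∀ (i : Fin 3) (q : MvPolynomial (Fin 3) ℝ),
      IntegrableOn (fun y => ev (wedge p₂ i) y * ev q y) P.carrier := fun i q =>
    ((continuous_ev _).mul (continuous_ev q)).integrableOn_of_isBounded P.isBounded
  have heq : ∀ v : P.space k, ∑ i, ∫ x in P.carrier, v.1 x i * ev (wedge p i) x =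
      (∑ i, ∫ x in P.carrier, v.1 x i * ev (wedge p₁ i) x) +
        ∑ i, polyInt (volume.restrict P.carrier) (ev (wedge p₂ i)) (hone i) (m i v) := by
    intro v
    -- The moments against `x ∧ p₂`, beyond the reach of the degrees of freedom, coincide with those
    -- of the projection `π`, which is the computed `m` by uniqueness.
    obtain ⟨π, hπ, h⟩ := v.2.2.2.2.2.2
    have hπm : ∀ i, π i = m i v := fun i => (hm i v (π i)).1 (hπ i)
    have h2 := h p₂ hp₂
    have e1 : ∀ i x, (v.1 x i - ev (π i) x) * xWedge p₂ x i =
        v.1 x i * ev (wedge p₂ i) x - ev (wedge p₂ i) x * ev (m i v) x := fun i x => by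
      rw [xWedge_eq, hπm]
      ring
    simp only [e1] at h2
    rw [integral_finsetSum _ fun i _ =>
      (integrableOn_space_mul_ev v i _).fun_sub (hone i _)] at h2
    have e2 : ∀ i, ∫ x in P.carrier, (v.1 x i * ev (wedge p₂ i) x -
        ev (wedge p₂ i) x * ev (m i v) x) = (∫ x in P.carrier, v.1 x i * ev (wedge p₂ i) x) -
          polyInt (volume.restrict P.carrier) (ev (wedge p₂ i)) (hone i) (m i v) := fun i =>
      integral_sub (integrableOn_space_mul_ev v i _) (hone i _)
    simp only [e2, Finset.sum_sub_distrib, sub_eq_zero] at h2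
    rw [← h2, ← Finset.sum_add_distrib, hp', wedge_add]
    refine Finset.sum_congr rfl fun i _ => ?_
    simp only [Pi.add_apply, ev_add, mul_add]
    exact integral_add (integrableOn_space_mul_ev v i _) (integrableOn_space_mul_ev v i _)
  rw [funext heq]
  exact add_mem_dofSpan (wedge_moment_low_mem_dofSpan hp₁)
    (sum_mem_dofSpan _ fun i _ => hΛ i _)

theorem moment_mem_dofSpan {ρ : ℝ} (hρ : 0 < ρ) (hP : P.ShapeRegular ρ) (hk : 2 ≤ k)
    (ht : ∀ e j, t e j ∈ Ioo (0 : ℝ) 1) (ht' : ∀ e, Function.Injective (t e))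
    (i : Fin 3) {r : MvPolynomial (Fin 3) ℝ} (hr : r ∈ polyLE 3 (k : ℤ)) :
    (fun v : P.space k => ∫ x in P.carrier, v.1 x i * ev r x) ∈ P.dofSpan k t :=
  moment_mem_dofSpan_of_wedge hρ hP hk ht ht' le_rfl
    (fun _ hp => wedge_moment_mem_dofSpan hρ hP hk ht ht' hp) i hr

/-- Integration by parts moves the derivative onto the test polynomial, leaving boundary terms and
moments of `v` of degree at most `k - 1`. -/
theorem computable_l2Proj_grad {ρ : ℝ} (hρ : 0 < ρ) (hP : P.ShapeRegular ρ) (hk : 2 ≤ k)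
    (ht : ∀ e j, t e j ∈ Ioo (0 : ℝ) 1) (ht' : ∀ e, Function.Injective (t e)) {n : ℤ}
    (hn : n ≤ k) (i j : Fin 3) :
    P.Computable k t fun v (p : MvPolynomial (Fin 3) ℝ) =>
      IsL2Proj P.carrier n (weakDeriv P.carrier j fun x => v x i) p :=
  computable_l2Proj P.isOpen P.isConnected.nonempty P.isBounded
    (w := fun v => weakDeriv P.carrier j fun x => v x i)
    (fun v hv => ((memH1_of_space ⟨v, hv⟩ i).2 j).2) fun _ hq =>
      weakDeriv_moment_mem_dofSpan hρ hP hk ht ht' i j (polyLE_mono (by omega) hq)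
        (moment_mem_dofSpan hρ hP hk ht ht' i (pderiv_mem_polyLE_of_le hq (by omega) j))

theorem computable_l2Proj_element {ρ : ℝ} (hρ : 0 < ρ) (hP : P.ShapeRegular ρ) (hk : 2 ≤ k)
    (ht : ∀ e j, t e j ∈ Ioo (0 : ℝ) 1) (ht' : ∀ e, Function.Injective (t e)) (i : Fin 3) :
    P.Computable k t fun v (p : MvPolynomial (Fin 3) ℝ) =>
      IsL2Proj P.carrier k (fun x => v x i) p :=
  computable_l2Proj P.isOpen P.isConnected.nonempty P.isBounded (w := fun v x => v x i)
    (fun v hv => (memH1_of_space ⟨v, hv⟩ i).1) fun _ hq =>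
      moment_mem_dofSpan hρ hP hk ht ht' i hq

end Polyhedron

end VEM

end

open VEM in
theorem proposition5p1 (P : Polyhedron) (ρ : ℝ) (hρ : 0 < ρ) (hP : P.ShapeRegular ρ)
    (k : ℕ) (hk : 2 ≤ k)
    (t : Fin P.nE → Fin (k - 1) → ℝ) (ht : ∀ e j, t e j ∈ Set.Ioo (0 : ℝ) 1)
    (ht' : ∀ e, Function.Injective (t e)) :
    -- the face projections `Π_k^{∇,f}` and `Π_{k+1}^{0,f}`
    (∀ f, P.Computable k t fun v (p : Fin 3 → MvPolynomial (Fin 2) ℝ) =>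
      ∀ i, IsNablaProj (P.region f) (P.faceBdry f) k (P.onFace f v i) (p i)) ∧
    (∀ f, P.Computable k t fun v (p : Fin 3 → MvPolynomial (Fin 2) ℝ) =>
      ∀ i, IsL2Proj (P.region f) (k + 1) (P.onFace f v i) (p i)) ∧
    -- the element projection `Π_k^{∇,P}`
    (P.Computable k t fun v (p : Fin 3 → MvPolynomial (Fin 3) ℝ) =>
      ∀ i, IsNablaProj P.carrier P.surf k (fun x => v x i) (p i)) ∧
    -- the projections `Π_{k-1}^{0,P}` and `Π_k^{0,P}` of the gradient
    (P.Computable k t fun v (p : Fin 3 → Fin 3 → MvPolynomial (Fin 3) ℝ) =>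
      ∀ i j, IsL2Proj P.carrier (k - 1) (weakDeriv P.carrier j fun x => v x i) (p i j)) ∧
    (P.Computable k t fun v (p : Fin 3 → Fin 3 → MvPolynomial (Fin 3) ℝ) =>
      ∀ i j, IsL2Proj P.carrier k (weakDeriv P.carrier j fun x => v x i) (p i j)) ∧
    -- the element projection `Π_k^{0,P}`
    (P.Computable k t fun v (p : Fin 3 → MvPolynomial (Fin 3) ℝ) =>
      ∀ i, IsL2Proj P.carrier k (fun x => v x i) (p i)) := by
  refine ⟨fun f => ?_, fun f => ?_, ?_, ?_, ?_, ?_⟩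
  · exact .pi fun i => Polyhedron.computable_face_nablaProj hρ hP hk ht ht' f i
  · exact .pi fun i => Polyhedron.computable_face_l2Proj hρ hP hk ht ht' f i
  · exact .pi fun i => Polyhedron.computable_nablaProj_element hρ hP hk ht ht' i
  · exact .pi fun i => .pi fun j =>
      Polyhedron.computable_l2Proj_grad hρ hP hk ht ht' (by omega) i j
  · exact .pi fun i => .pi fun j =>
      Polyhedron.computable_l2Proj_grad hρ hP hk ht ht' le_rfl i j
  · exact .pi fun i => Polyhedron.computable_l2Proj_element hρ hP hk ht ht' i
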